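/- Let $K$ be a Noetherian commutative ring and let $\mathbf{FI}$ be the category of finite sets with injections. An $\mathbf{FI}$-algebra over $K$ is a covariant functor from $\mathbf{FI}$ to commutative unital $K$-algebras, and a morphism of $\mathbf{FI}$-algebras is a natural transformation. A set $D\subseteq\bigsqcup_S A(S)$ generates $A$ if no proper $\mathbf{FI}$-subalgebra of $A$ contains $D$, and $A$ is finitely generated if some finite $D$ generates it. The width of $f\in A(S)$ is the minimal $n$ such that $f\in A(\pi)A([n])$ for some injection $\pi:[n]\to S$, and $A$ is generated in width at most $d$ if it is generated by a collection of elements of width at most $d$. An $\mathbf{FI}$-ideal $I$ of $A$ is a family of ideals $I(S)\subseteq A(S)$ with $A(\pi)I(S)\subseteq I(T)$ for every injection $\pi:S\to T$; it is finitely generated if it is the smallest $\mathbf{FI}$-ideal containing some finite set of elements; its radical $\operatorname{rad}(I)$ is taken in each $A(S)$. An $\mathbf{FI^{op}}$-scheme over $K$ is a contravariant functor $X$ from $\mathbf{FI}$ to $K$-schemes; a closed subscheme $Z$ of $X$ is a subfunctor with each $Z(S)$ a closed subscheme of $X(S)$, and $Z$ is reduced if each $Z(S)$ is. We call $X$ topologically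 Noetherian if every descending chain $Z_0\supseteq Z_1\supseteq\cdots$ of reduced closed subschemes of $X$ stabilises. **Theorem.** Let $\phi:B\to A$ be a morphism of finitely generated $\mathbf{FI}$-algebras over $K$, and suppose that $A$ is generated in width at most $1$. Let $\phi^*:\operatorname{Spec}A\to\operatorname{Spec}B$ be the dual morphism of $\mathbf{FI^{op}}$-schemes, and let $\overline{\operatorname{Im}(\phi^*)}$ be the reduced closed subscheme of $\operatorname{Spec}B$ whose underlying set, for each finite set $S$, is the Zariski closure of the image of $\operatorname{Spec}A(S)\to\operatorname{Spec}B(S)$. Then: 1. $\overline{\operatorname{Im}(\phi^*)}$ is defined, as a set, by finitely many elements of $B$: there are finitely many elements $f_1\in B(S_1),\dots,f_m\in B(S_m)$ such that, for every finite set $S$, a prime $p$ of $B(S)$ lies in $\overline{\operatorname{Im}(\phi^*)}(S)$ if and only if $B(\sigma)f_i\in p$ for all $i$ and all injections $\sigma:S_i\to S$. 2. Equivalently, there is a finitely generated $\mathbf{FI}$-ideal $I$ of $B$ with $\operatorname{rad}(I)=\operatorname{rad}(\operatorname{Ker}\phi)$. 3. $\overline{\operatorname{Im}(\phi^*)}$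 is topologically Noetherian. -/

import Mathlib

open CategoryTheory AlgebraicGeometry

universe u

/-! ### The category of finite sets and injections -/

/-- Objects of `FI`: finite sets. -/
structure FI : Type 1 where
  of ::
  carrier : Type
  [finite : Finite carrier]

attribute [instance] FI.finite

/-- Morphisms of `FI`: injective maps. -/
instance FI.instCategory : Category FI where
  Hom S T := S.carrier ↪ T.carrier
  id S := Function.Embedding.refl S.carrier
  comp f g := Function.Embedding.trans f g

/-- The finite set `[n]` with `n` elements. -/
def FI.fin (n : ℕ) : FI := FI.of (Fin n)

/-! ### FI-algebras -/

/-- An FI-algebra over `K`: a covariant functor from `FI` to commutative unital `K`-algebras.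
Morphisms of FI-algebras are natural transformations. -/
abbrev FIAlgebra (K : Type u) [CommRing K] := FI ⥤ CommAlgCat.{u} K

namespace FIAlgebra

variable {K : Type u} [CommRing K]

/-- The disjoint union of all `A(S)`. -/
abbrev Element (A : FIAlgebra K) := Σ S : FI, A.obj S

/-- A sub-FI-algebra: a family of subalgebras `B(S) ⊆ A(S)` preserved by the maps of `A`. -/
structure Sub (A : FIAlgebra K) where
  obj : ∀ S : FI, Subalgebra K (A.obj S)
  map_mem : ∀ {S T : FI} (f : S ⟶ T) {a : A.obj S}, a ∈ obj S → (A.map f).hom a ∈ obj T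

/-- `A` is generated by `D`: the set `D` is contained in no proper subalgebra of `A`. -/
def IsGeneratedBy (A : FIAlgebra K) (D : Set A.Element) : Prop :=
  ∀ C : A.Sub, (∀ x ∈ D, x.2 ∈ C.obj x.1) → ∀ S : FI, C.obj S = ⊤

/-- `A` is finitely generated. -/
def IsFinitelyGenerated (A : FIAlgebra K) : Prop :=
  ∃ D : Set A.Element, D.Finite ∧ A.IsGeneratedBy D

/-- The width of `x ∈ A(S)`: the minimal `n` such that `x` lies in `A(π) A([n])` for some
injection `π : [n] → S`. -/
noncomputable def width (A : FIAlgebra K) (x : A.Element) : ℕ :=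
  sInf {n : ℕ | ∃ (π : FI.fin n ⟶ x.1) (a : A.obj (FI.fin n)), (A.map π).hom a = x.2}

/-- The set in the definition of the width is non-empty. -/
theorem width_set_nonempty (A : FIAlgebra K) (x : A.Element) :
    {n : ℕ | ∃ (π : FI.fin n ⟶ x.1) (a : A.obj (FI.fin n)), (A.map π).hom a = x.2}.Nonempty := by
  let e := Finite.equivFin x.1.carrier
  let π : FI.fin (Nat.card x.1.carrier) ⟶ x.1 := e.symm.toEmbedding
  let ρ : x.1 ⟶ FI.fin (Nat.card x.1.carrier) := e.toEmbedding
  have h : ρ ≫ π = 𝟙 x.1 := by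
    apply Function.Embedding.ext
    intro i
    exact e.symm_apply_apply i
  refine ⟨Nat.card x.1.carrier, π, (A.map ρ).hom x.2, ?_⟩
  rw [← CommAlgCat.comp_apply, ← A.map_comp, h, A.map_id]
  rfl

/-- `A` is generated in width at most `d`: some collection of elements of width at most `d`
generates `A`. -/
def IsGeneratedInWidthLE (A : FIAlgebra K) (d : ℕ) : Prop :=
  ∃ D : Set A.Element, (∀ x ∈ D, A.width x ≤ d) ∧ A.IsGeneratedBy D

/-- An FI-ideal of `A`. -/
@[ext]
structure FIIdeal (A : FIAlgebra K) where
  obj : ∀ S : FI, Ideal (A.obj S)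
  map_mem : ∀ {S T : FI} (f : S ⟶ T) {a : A.obj S}, a ∈ obj S → (A.map f).hom a ∈ obj T

/-- An FI-ideal `I` is finitely generated: it is the smallest FI-ideal containing some finite
set of elements. -/
def FIIdeal.IsFinitelyGenerated {A : FIAlgebra K} (I : A.FIIdeal) : Prop :=
  ∃ D : Set A.Element, D.Finite ∧ (∀ x ∈ D, x.2 ∈ I.obj x.1) ∧
    ∀ J : A.FIIdeal, (∀ x ∈ D, x.2 ∈ J.obj x.1) → ∀ S : FI, I.obj S ≤ J.obj S

/-- The radical of an FI-ideal, taken in each `A(S)`. -/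
def FIIdeal.radical {A : FIAlgebra K} (I : A.FIIdeal) : A.FIIdeal where
  obj S := (I.obj S).radical
  map_mem f := by
    rintro a ⟨n, hn⟩
    exact ⟨n, by simpa using I.map_mem f hn⟩

/-- The kernel of a morphism of FI-algebras. -/
def ker {B A : FIAlgebra K} (φ : B ⟶ A) : B.FIIdeal where
  obj S := RingHom.ker (φ.app S).hom
  map_mem {S T} f b hb := by
    rw [RingHom.mem_ker] at hb ⊢
    rw [← CommAlgCat.comp_apply, φ.naturality, CommAlgCat.comp_apply, hb, map_zero]

end FIAlgebra

/-! ### FI^op-schemes -/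

/-- An FI^op-scheme over `K`: a contravariant functor from `FI` to schemes over `K`. -/
abbrev FIOpScheme (K : Type u) [CommRing K] := FIᵒᵖ ⥤ Over (Spec (CommRingCat.of K))

namespace FIOpScheme

variable {K : Type u} [CommRing K]

/-- The underlying scheme of `X(S)`. -/
noncomputable abbrev at_ (X : FIOpScheme K) (S : FI) : Scheme.{u} := (X.obj (Opposite.op S)).left

/-- The morphism `X(T) ⟶ X(S)` attached to an injection `S → T`. -/
noncomputable abbrev res (X : FIOpScheme K) {S T : FI} (f : S ⟶ T) : X.at_ T ⟶ X.at_ S := (X.map f.op).left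

/-- A closed subscheme of an FI^op-scheme `X`: closed subschemes `Z(S)` of `X(S)`, given by their
(quasi-coherent) ideal sheaves, such that every `X(T) ⟶ X(S)` restricts to a morphism
`Z(T) ⟶ Z(S)`. -/
@[ext]
structure ClosedSubscheme (X : FIOpScheme K) where
  ideal : ∀ S : FI, (X.at_ S).IdealSheafData
  exists_restriction : ∀ {S T : FI} (f : S ⟶ T),
    ∃ g : (ideal T).subscheme ⟶ (ideal S).subscheme,
      g ≫ (ideal S).subschemeι = (ideal T).subschemeι ≫ X.res f

namespace ClosedSubscheme

variable {X : FIOpScheme K}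

/-- `Z ≤ Z'` if `Z(S)` is a closed subscheme of `Z'(S)` for all `S`. -/
instance : LE X.ClosedSubscheme where
  le Z Z' := ∀ S : FI, Z'.ideal S ≤ Z.ideal S

/-- The underlying closed subset of `X(S)`. -/
def support (Z : X.ClosedSubscheme) (S : FI) : Set (X.at_ S) := (Z.ideal S).support

/-- `Z` is reduced: every `Z(S)` is a reduced scheme. -/
def IsReduced (Z : X.ClosedSubscheme) : Prop :=
  ∀ S : FI, AlgebraicGeometry.IsReduced (Z.ideal S).subscheme

/-- A closed subscheme of `X`, as an FI^op-scheme in its own right. -/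
noncomputable def toFIOpScheme (Z : X.ClosedSubscheme) : FIOpScheme K where
  obj S := Over.mk ((Z.ideal S.unop).subschemeι ≫ (X.obj S).hom)
  map {T S} f := Over.homMk (Z.exists_restriction f.unop).choose (by
    have h := (Z.exists_restriction f.unop).choose_spec
    have hw := Over.w (X.map f)
    simp only [Over.mk_left, Over.mk_hom]
    rw [reassoc_of% h]
    exact congrArg _ hw)
  map_id S := by
    ext1
    rw [← cancel_mono (Z.ideal S.unop).subschemeι]
    have h := (Z.exists_restriction (𝟙 S.unop)).choose_spec
    refine h.trans ?_
    simp [res]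
  map_comp {S T U} f g := by
    ext1
    rw [← cancel_mono (Z.ideal U.unop).subschemeι]
    have h := (Z.exists_restriction (f ≫ g).unop).choose_spec
    have h₁ := (Z.exists_restriction f.unop).choose_spec
    have h₂ := (Z.exists_restriction g.unop).choose_spec
    refine h.trans ?_
    simp only [Over.comp_left, Over.homMk_left, Category.assoc]
    erw [h₂, reassoc_of% h₁]
    simp [res]

end ClosedSubscheme

/-- `X` is topologically Noetherian: every descending chain of reduced closed subschemes of the
FI^op-scheme `X` stabilises. -/
def IsTopologicallyNoetherian (X : FIOpScheme K) : Prop :=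
  ∀ Z : ℕ → X.ClosedSubscheme, (∀ n, (Z n).IsReduced) → (∀ n, Z (n + 1) ≤ Z n) →
    ∃ N, ∀ n, N ≤ n → Z n = Z N

/-- The Zariski closure of the image of a morphism `f : Y ⟶ X` of FI^op-schemes, as a closed
subscheme of `X`: for each `S` the closure of the image of `Y(S)` in `X(S)`, with its reduced
scheme structure. -/
noncomputable def imageClosure {Y X : FIOpScheme K} (f : Y ⟶ X) : X.ClosedSubscheme where
  ideal S := Scheme.IdealSheafData.vanishingIdeal
    ⟨closure (Set.range (f.app (Opposite.op S)).left), isClosed_closure⟩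
  exists_restriction {S T} g := by
    refine ⟨Scheme.IdealSheafData.subschemeMap _ _ (X.res g) ?_,
      Scheme.IdealSheafData.subschemeMap_subschemeι _ _ _ _⟩
    rw [Scheme.IdealSheafData.map_vanishingIdeal]
    apply Scheme.IdealSheafData.vanishingIdeal_antimono
    have hn : (f.app (Opposite.op T)).left ≫ X.res g =
        Y.res g ≫ (f.app (Opposite.op S)).left :=
      (congrArg CommaMorphism.left (f.naturality g.op)).symm
    refine TopologicalSpace.Closeds.closure_le.mpr ?_
    refine (image_closure_subset_closure_image (X.res g).continuous).trans (closure_mono ?_)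
    rintro _ ⟨_, ⟨y, rfl⟩, rfl⟩
    refine ⟨Y.res g y, ?_⟩
    rw [← Scheme.Hom.comp_apply, ← Scheme.Hom.comp_apply, hn]

/-- The points of the image closure are the closure of the image. -/
theorem support_imageClosure {Y X : FIOpScheme K} (f : Y ⟶ X) (S : FI) :
    (imageClosure f).support S = closure (Set.range (f.app (Opposite.op S)).left) :=
  Scheme.IdealSheafData.coe_support_vanishingIdeal _

/-- The image closure is reduced. -/
theorem imageClosure_isReduced {Y X : FIOpScheme K} (f : Y ⟶ X) : (imageClosure f).IsReduced := by
  intro S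
  have (U : ((imageClosure f).ideal S).subschemeCover.openCover.I₀) :
      AlgebraicGeometry.IsReduced (((imageClosure f).ideal S).subschemeCover.openCover.X U) := by
    have h : (((imageClosure f).ideal S).ideal U).IsRadical :=
      PrimeSpectrum.isRadical_vanishingIdeal _
    have h' : _root_.IsReduced (Γ(X.at_ S, U.1) ⧸ ((imageClosure f).ideal S).ideal U) :=
      (Ideal.isRadical_iff_quotient_reduced _).mp h
    exact inferInstanceAs (AlgebraicGeometry.IsReduced
      (Spec (.of (Γ(X.at_ S, U.1) ⧸ ((imageClosure f).ideal S).ideal U))))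
  exact IsReduced.of_openCover _ ((imageClosure f).ideal S).subschemeCover.openCover

end FIOpScheme

namespace FIAlgebra

variable {K : Type u} [CommRing K]

/-- The spectrum of an FI-algebra. -/
noncomputable def spec (A : FIAlgebra K) : FIOpScheme K :=
  A.op ⋙ algSpec (CommRingCat.of K)

/-- The morphism `φ^* : Spec A ⟶ Spec B` dual to a morphism `φ : B ⟶ A` of FI-algebras. -/
noncomputable def specMap {B A : FIAlgebra K} (φ : B ⟶ A) : A.spec ⟶ B.spec :=
  Functor.whiskerRight (NatTrans.op φ) (algSpec (CommRingCat.of K))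

/-- On points, `Spec A(S) ⟶ Spec B(S)` is the contraction of prime ideals along `φ_S`. -/
theorem specMap_app_apply {B A : FIAlgebra K} (φ : B ⟶ A) (S : FI) (p : PrimeSpectrum (A.obj S)) :
    ((specMap φ).app (Opposite.op S)).left p =
      (PrimeSpectrum.comap (φ.app S).hom.toRingHom p : PrimeSpectrum (B.obj S)) :=
  rfl

/-- The closed subset of `Spec B(S)` defined by elements `D` of `B`: the primes `p` of `B(S)` such
that `B(σ) b ∈ p` for all `b ∈ B(T)` in `D` and all injections `σ : T → S`. -/
def zeroLocus (B : FIAlgebra K) (D : Set B.Element) (S : FI) : Set (B.spec.at_ S) :=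
  {p : PrimeSpectrum (B.obj S) | ∀ x ∈ D, ∀ σ : x.1 ⟶ S, (B.map σ).hom x.2 ∈ p.asIdeal}

end FIAlgebra

/-! Finitely many generators of `B` turn a prime of `B(S)` into a finite family of tensors over its
residue field, with indices in `S`. As `A` is generated in width one, for each `w ∈ T` an element of
`A(T)` is a finite sum of products of an element from `{w}` and one from `T \ {w}`. So the
flattenings of tensors coming from `A` have rank at most some `N`: the minors of size `N + 1` lie in
the kernel of `φ` (`exists_minorElements_mem_ker`). Up to injections these are finitely many
elements of `B`. It remains to show that on tensors of bounded flattening rank every system of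
equations is equivalent to a finite subsystem (`isNoeth_rankClass`). Applied to the kernel this
gives finitely many equations for the closure; applied to the equations of a descending chain it
gives stabilisation.

The Noetherian statement is proved by eliminating tensors. Take a tensor of maximal arity, at least
two, and a flattening of exact rank `r` with a non-zero `r`-minor, whose indices form a finite set
`S₀`. The vanishing of the bordered minors expresses every entry with indices outside `S₀` through
entries having some index in `S₀` and the inverse of the minor (`y_eq_sum`). Fixing indices in `S₀`
thus trades the tensor for tensors of smaller arity and one scalar (`isNoeth_exactRankClass`). Once
all arities are at most one, Noetherianity up to injections follows from Higman's lemma and leading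
coefficients (`RowIdeal.exists_finite_gen_eq`). -/

/-! ### Points of tensor spaces over varying finite index sets -/

/-- The coordinates on families of tensors of shapes `W j` with entries indexed by `T`. -/
abbrev TensorVar {J : Type} (W : J → Type) (T : Type) := Σ j, (W j → T)

/-- A family of tensors of shapes `W j` with indices in a set `S` and entries in a field `Ω` over
`K`, such that entries with repeated indices are zero. -/
structure TensorPoint (K : Type u) [CommRing K] {J : Type} (W : J → Type) where
  S : Type
  Ω : Type u
  [field : Field Ω]
  coeff : K →+* Ω
  y : ∀ j, (W j → S) → Ω
  y_eq_zero : ∀ j f, ¬ Function.Injective f → y j f = 0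

attribute [instance] TensorPoint.field

/-- Polynomial equations in the entries of tensors. -/
abbrev TensorEquation (K : Type u) [CommRing K] {J : Type} (W : J → Type) :=
  Σ T : FI, MvPolynomial (TensorVar W T.carrier) K

namespace TensorPoint

variable {K : Type u} [CommRing K] {J : Type} {W : J → Type}

/-- Evaluation of a polynomial at a family of tensors, along a map of index sets. -/
noncomputable def eval (M : TensorPoint K W) {T : Type} (σ : T → M.S) :
    MvPolynomial (TensorVar W T) K →+* M.Ω :=
  MvPolynomial.eval₂Hom M.coeff (fun v => M.y v.1 (σ ∘ v.2))

/-- `M` satisfies an equation if all its translates along injections vanish at `M`. -/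
def Satisfies (M : TensorPoint K W) (F : TensorEquation K W) : Prop :=
  ∀ σ : F.1.carrier → M.S, Function.Injective σ → M.eval σ F.2 = 0

/-- A class of points is Noetherian if on it every system of equations is equivalent to a finite
subsystem. -/
def IsNoeth (C : Set (TensorPoint K W)) : Prop :=
  ∀ E : Set (TensorEquation K W), ∃ E₀ ⊆ E, E₀.Finite ∧
    ∀ M ∈ C, (∀ F ∈ E₀, M.Satisfies F) → ∀ F ∈ E, M.Satisfies F

theorem IsNoeth.mono {C C' : Set (TensorPoint K W)} (h : C ⊆ C') (hC : IsNoeth C') :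
    IsNoeth C := by
  intro E
  obtain ⟨E₀, h₀, hf, hE⟩ := hC E
  exact ⟨E₀, h₀, hf, fun M hM => hE M (h hM)⟩

theorem IsNoeth.empty : IsNoeth (∅ : Set (TensorPoint K W)) :=
  fun _ => ⟨∅, Set.empty_subset _, Set.finite_empty, fun _ h => h.elim⟩

theorem IsNoeth.iUnion {ι : Type*} [Finite ι] {C : ι → Set (TensorPoint K W)}
    (h : ∀ i, IsNoeth (C i)) : IsNoeth (⋃ i, C i) := by
  intro E
  choose E₀ h₀ hf hE using fun i => h i E
  refine ⟨⋃ i, E₀ i, Set.iUnion_subset h₀, Set.finite_iUnion hf, ?_⟩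
  intro M hM hs
  obtain ⟨i, hi⟩ := Set.mem_iUnion.mp hM
  exact hE i M hi fun F hF => hs F (Set.mem_iUnion_of_mem i hF)

theorem IsNoeth.union {C C' : Set (TensorPoint K W)} (h : IsNoeth C) (h' : IsNoeth C') :
    IsNoeth (C ∪ C') := by
  rw [Set.union_eq_iUnion]
  exact IsNoeth.iUnion (by rintro (_ | _) <;> assumption)

/-- Noetherianity can be pulled back along a translation of equations. -/
theorem IsNoeth.of_translation {J' : Type} {W' : J' → Type} {C : Set (TensorPoint K W)}
    {C' : Set (TensorPoint K W')} (hC' : IsNoeth C')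
    (tr : TensorEquation K W → Set (TensorEquation K W'))
    (h : ∀ M ∈ C, ∃ M' ∈ C', ∀ F, M.Satisfies F ↔ ∀ G ∈ tr F, M'.Satisfies G) :
    IsNoeth C := by
  intro E
  obtain ⟨E', hE', hf, hs⟩ := hC' (⋃ F ∈ E, tr F)
  -- Each of the finitely many translated equations comes from one original equation; these form the
  -- required finite subsystem.
  have hch : ∀ G : E', ∃ F ∈ E, G.1 ∈ tr F := fun G => by
    simpa using hE' G.2
  choose g hgE hg using hch
  have := hf.to_subtype
  refine ⟨Set.range g, by rintro _ ⟨G, rfl⟩; exact hgE G, Set.finite_range g, ?_⟩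
  intro M hM hM₀ F hF
  obtain ⟨M', hM', hMM'⟩ := h M hM
  rw [hMM']
  intro G hG
  refine hs M' hM' (fun G' hG' => ?_) G (Set.mem_biUnion hF hG)
  exact (hMM' _).mp (hM₀ _ ⟨⟨G', hG'⟩, rfl⟩) _ (hg ⟨G', hG'⟩)

/-! ### Minors of flattenings -/

open scoped Classical in
/-- The minor of the flattening of `y j` along the coordinate `w`, with rows `a` and columns `c`
(whose value at `w` is irrelevant). -/
noncomputable def minor (M : TensorPoint K W) (j : J) (w : W j) {ι : Type} [Fintype ι] [DecidableEq ι]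
    (a : ι → M.S) (c : ι → W j → M.S) : M.Ω :=
  (Matrix.of fun i m => M.y j (Function.update (c m) w (a i))).det

open scoped Classical in
/-- Rows `a` and columns `c` such that all entries have distinct indices. -/
def AdmissibleMinor {V S : Type} (w : V) {ι : Type} (a : ι → S) (c : ι → V → S) : Prop :=
  ∀ i m, Function.Injective (Function.update (c m) w (a i))

/-- The flattening of `y j` along `w` has no admissible non-zero minor of size `r`. -/
def VanishingMinors (M : TensorPoint K W) (j : J) (w : W j) (r : ℕ) : Prop :=
  ∀ (a : Fin r → M.S) (c : Fin r → W j → M.S), AdmissibleMinor w a c → M.minor j w a c = 0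

variable (K W) in
/-- The points all of whose flattenings have rank at most `N`. -/
def rankClass (N : ℕ) : Set (TensorPoint K W) :=
  {M | ∀ j w, M.VanishingMinors j w (N + 1)}

/-- The empty determinant is `1`. This makes the initial class in the induction on rank empty. -/
theorem not_vanishingMinors_zero (M : TensorPoint K W) (j : J) (w : W j) :
    ¬ M.VanishingMinors j w 0 := by
  intro h
  have := h Fin.elim0 Fin.elim0 (fun i => i.elim0)
  simp [minor] at this

theorem _root_.Function.injective_update_iff {V S : Type*} [DecidableEq V] {g : V → S} {w : V}
    {x : S} : Function.Injective (Function.update g w x) ↔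
      (∀ v v', v ≠ w → v' ≠ w → g v = g v' → v = v') ∧ ∀ v, v ≠ w → g v ≠ x := by
  constructor
  · intro h
    refine ⟨fun v v' hv hv' e => h (by simpa [hv, hv'] using e), fun v hv e => hv (h ?_)⟩
    simpa [hv] using e
  · rintro ⟨h₁, h₂⟩ v v' e
    by_cases hv : v = w <;> by_cases hv' : v' = w
    · rw [hv, hv']
    · simp only [hv, Function.update_self, Function.update_of_ne hv'] at e
      exact (h₂ v' hv' e.symm).elim
    · simp only [hv', Function.update_self, Function.update_of_ne hv] at e
      exact (h₂ v hv e).elim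
    · simp only [Function.update_of_ne hv, Function.update_of_ne hv'] at e
      exact h₁ v v' hv hv' e

/-- The bordered determinant is `det A` times the Schur complement `d - b A⁻¹ c`. -/
theorem _root_.Matrix.eq_sum_of_det_fromBlocks_eq_zero {F : Type*} [Field F] {n : Type*}
    [Fintype n] [DecidableEq n] (A : Matrix n n F) (b c : n → F) (d : F) (hA : A.det ≠ 0)
    (h : (Matrix.fromBlocks A (Matrix.of fun i (_ : Unit) => c i)
      (Matrix.of fun (_ : Unit) i => b i) (Matrix.of fun _ _ => d)).det = 0) :
    d = ∑ m, ∑ i, b m * (A.det⁻¹ * A.adjugate m i) * c i := by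
  have : Invertible A := Matrix.invertibleOfIsUnitDet A (isUnit_iff_ne_zero.mpr hA)
  rw [Matrix.det_fromBlocks₁₁] at h
  have h' := (mul_eq_zero.mp h).resolve_left hA
  rw [Matrix.det_unique] at h'
  simp only [Matrix.sub_apply, Matrix.of_apply, Matrix.mul_apply, sub_eq_zero] at h'
  rw [h', Finset.sum_comm]
  refine Finset.sum_congr rfl fun i _ => ?_
  rw [Finset.sum_mul]
  refine Finset.sum_congr rfl fun m _ => ?_
  rw [Matrix.invOf_eq_nonsing_inv, Matrix.inv_def, Ring.inverse_eq_inv']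
  simp

open scoped Classical in
/-- If the minors of size `r + 1` vanish and the minor with rows `a` and columns `c` does not,
the entries of the tensor disjoint from `a` and `c` can be expressed in other entries. -/
theorem y_eq_sum (M : TensorPoint K W) {j : J} {w : W j} {r : ℕ}
    (hv : M.VanishingMinors j w (r + 1)) (a : Fin r → M.S) (c : Fin r → W j → M.S)
    (hm : M.minor j w a c ≠ 0) (hac : AdmissibleMinor w a c)
    (f : W j → M.S) (hf : Function.Injective f)
    (hfa : ∀ v i, f v ≠ a i) (hfc : ∀ v m v', v' ≠ w → f v ≠ c m v') :
    M.y j f = ∑ m, ∑ i, M.y j (Function.update (c m) w (f w)) *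
      ((M.minor j w a c)⁻¹ *
        (Matrix.of fun i m => M.y j (Function.update (c m) w (a i))).adjugate m i) *
      M.y j (Function.update f w (a i)) := by
  let e : Fin r ⊕ Unit ≃ Fin (r + 1) :=
    (Equiv.sumCongr (Equiv.refl _) (Equiv.ofUnique Unit (Fin 1))).trans finSumFinEquiv
  let a' : Fin r ⊕ Unit → M.S := Sum.elim a fun _ => f w
  let c' : Fin r ⊕ Unit → W j → M.S := Sum.elim c fun _ => f
  -- The minor is bordered by the row `f w` and the column `f`. Disjointness of `f` from `a` and
  -- from the columns off `w` keeps the indices in each mixed entry distinct.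
  have hadm : AdmissibleMinor w (a' ∘ e.symm) (c' ∘ e.symm) := by
    intro i m
    simp only [Function.comp_apply]
    rcases e.symm i with i | i <;> rcases e.symm m with m | m
    · exact hac i m
    · exact Function.injective_update_iff.mpr
        ⟨fun v v' _ _ h => hf h, fun v _ => hfa v i⟩
    · exact Function.injective_update_iff.mpr
        ⟨(Function.injective_update_iff.mp (hac m m)).1, fun v hv h => hfc w m v hv h.symm⟩
    · simpa [a', c'] using hf
  have := hv _ _ hadm
  rw [minor] at this
  refine Matrix.eq_sum_of_det_fromBlocks_eq_zero
    (Matrix.of fun i m => M.y j (Function.update (c m) w (a i)))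
    (fun m => M.y j (Function.update (c m) w (f w))) (fun i => M.y j (Function.update f w (a i)))
    (M.y j f) hm ?_
  rw [← this, ← Matrix.det_submatrix_equiv_self e.symm]
  congr 1
  ext i m
  simp only [Matrix.submatrix_apply, Matrix.of_apply, Function.comp_apply]
  rcases e.symm i with i | i <;> rcases e.symm m with m | m <;> simp [a', c']

end TensorPoint

namespace TensorPoint

variable {K : Type u} [CommRing K] {J : Type} {W : J → Type}

/-! ### Splitting index sets -/

section Glue

variable {V S₀ T T' : Type}

/-- The positions at which a map into a disjoint union takes values in the left part. -/
def leftPart (f : V → S₀ ⊕ T) (v : V) : Option S₀ := (f v).getLeft?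

/-- The restriction of a map into a disjoint union to the preimage of the right part. -/
def rightPart (f : V → S₀ ⊕ T) (v : {v // leftPart f v = none}) : T :=
  (f v.1).getRight (by simpa [leftPart] using v.2)

/-- A map into a disjoint union with prescribed left and right parts. -/
def glue (p : V → Option S₀) (τ : {v // p v = none} → T) (v : V) : S₀ ⊕ T :=
  match h : p v with
  | some s => Sum.inl s
  | none => Sum.inr (τ ⟨v, h⟩)

theorem glue_of_eq_none {p : V → Option S₀} (τ : {v // p v = none} → T) {v : V}
    (h : p v = none) : glue p τ v = Sum.inr (τ ⟨v, h⟩) := by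
  unfold glue
  split
  · simp_all
  · rfl

theorem glue_of_eq_some {p : V → Option S₀} (τ : {v // p v = none} → T) {v : V} {s : S₀}
    (h : p v = some s) : glue p τ v = Sum.inl s := by
  unfold glue
  split <;> simp_all

/-- An index tuple is determined by its pattern of fixed indices, which selects a shifted tensor,
and by its free indices, which select an entry of it. -/
theorem glue_leftPart (f : V → S₀ ⊕ T) (g : T → T') :
    glue (leftPart f) (g ∘ rightPart f) = Sum.map id g ∘ f := by
  funext v
  rcases h : f v with s | t
  · rw [glue_of_eq_some (s := s) _ (by simp [leftPart, h])]
    simp [h]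
  · rw [glue_of_eq_none _ (by simp [leftPart, h])]
    simp [rightPart, h]

theorem injective_of_glue {p : V → Option S₀} {τ : {v // p v = none} → T}
    (h : Function.Injective (glue p τ)) : Function.Injective τ := by
  rintro ⟨v, hv⟩ ⟨v', hv'⟩ e
  refine Subtype.ext (h ?_)
  rw [glue_of_eq_none _ hv, glue_of_eq_none _ hv', e]

theorem glue_injective {p : V → Option S₀} {τ : {v // p v = none} → T}
    (hp : ∀ v v' s, p v = some s → p v' = some s → v = v') (hτ : Function.Injective τ) :
    Function.Injective (glue p τ) := by
  intro v v' e
  rcases h : p v with _ | s <;> rcases h' : p v' with _ | s'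
  · rw [glue_of_eq_none _ h, glue_of_eq_none _ h', Sum.inr.injEq] at e
    exact congrArg Subtype.val (hτ e)
  · rw [glue_of_eq_none _ h, glue_of_eq_some _ h'] at e
    simp at e
  · rw [glue_of_eq_some _ h, glue_of_eq_none _ h'] at e
    simp at e
  · rw [glue_of_eq_some _ h, glue_of_eq_some _ h', Sum.inl.injEq] at e
    exact hp v v' s h (e ▸ h')

theorem partialInjective_of_glue {p : V → Option S₀} {τ : {v // p v = none} → T}
    (h : Function.Injective (glue p τ)) (v v' : V) (s : S₀) (hv : p v = some s)
    (hv' : p v' = some s) : v = v' :=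
  h (by rw [glue_of_eq_some _ hv, glue_of_eq_some _ hv'])

theorem glue_update {p : V → Option S₀} [DecidableEq V] [DecidableEq {v // p v = none}] (τ : {v // p v = none} → T) (w : {v // p v = none})
    (t : T) :
    glue p (Function.update τ w t) = Function.update (glue p τ) w.1 (Sum.inr t) := by
  funext v
  by_cases hv : v = w.1
  · subst hv
    rw [glue_of_eq_none _ w.2]
    simp
  · rw [Function.update_of_ne hv]
    rcases h : p v with _ | s
    · rw [glue_of_eq_none _ h, glue_of_eq_none _ h, Function.update_of_ne]
      exact fun e => hv (congrArg Subtype.val e)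
    · rw [glue_of_eq_some _ h, glue_of_eq_some _ h]

end Glue

/-! ### Shifting by a finite set and eliminating a tensor -/

variable (W) in
/-- The tensors obtained by fixing some of the indices in `S₀`, except for the full tensor `j₀`,
together with one additional scalar. -/
abbrev ShiftIndex (j₀ : J) (S₀ : Type) : Type :=
  Option {p : Σ j, (W j → Option S₀) // ¬ (p.1 = j₀ ∧ ∀ v, p.2 v = none)}

variable (W) in
/-- The shapes of the tensors obtained by fixing some of the indices. -/
def shiftShape (j₀ : J) (S₀ : Type) : ShiftIndex W j₀ S₀ → Type
  | none => Empty
  | some p => {v // p.1.2 v = none}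

/-- The tensors obtained from `M` by fixing some of the indices, and the scalar `x`. -/
def shift (M : TensorPoint K W) (j₀ : J) {S₀ T : Type} (κ : S₀ ⊕ T → M.S)
    (x : M.Ω) : TensorPoint K (shiftShape W j₀ S₀) where
  S := T
  Ω := M.Ω
  coeff := M.coeff
  y := fun
    | none => fun _ => x
    | some p => fun τ => M.y p.1.1 (κ ∘ glue p.1.2 τ)
  y_eq_zero := by
    rintro (_ | p) f hf
    · exact (hf (fun v => v.elim)).elim
    · exact M.y_eq_zero _ _ fun h => hf (injective_of_glue h.of_comp)

/-- Fixing indices restricts the columns of a flattening, so the minors of a shifted tensor are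
minors of the original one. The additional scalar has no flattenings. -/
theorem shift_mem_rankClass {M : TensorPoint K W} {N : ℕ} (hM : M ∈ rankClass K W N) (j₀ : J)
    {S₀ T : Type} (κ : S₀ ⊕ T → M.S) (hκ : Function.Injective κ) (x : M.Ω) :
    M.shift j₀ κ x ∈ rankClass K (shiftShape W j₀ S₀) N := by
  classical
  rintro (_ | ⟨⟨j, p⟩, hp⟩) w a c hac
  · exact w.elim
  · change {v // p v = none} at w
    change Fin (N + 1) → {v // p v = none} → T at c
    change Fin (N + 1) → T at a
    have hent : ∀ (_ : DecidableEq {v // p v = none}) i m, Function.update (κ ∘ glue p (c m)) w.1 (κ (Sum.inr (a i))) =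
        κ ∘ glue p (Function.update (c m) w (a i)) := by
      intro _ i m
      rw [glue_update, ← Function.comp_update]
    by_cases hpi : ∀ v v' s, p v = some s → p v' = some s → v = v'
    · refine Eq.trans ?_
        (hM j w.1 (fun i => κ (Sum.inr (a i))) (fun m => κ ∘ glue p (c m)) ?_)
      · unfold minor
        congr 1
        ext i m
        simp only [Matrix.of_apply]
        exact congrArg (M.y j) (hent _ i m).symm
      · intro i m
        have := hκ.comp (glue_injective hpi (hac i m))
        exact (hent _ i m).symm ▸ this
    -- A pattern using an index of `S₀` twice gives the zero tensor, and the determinant of a zero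
    -- matrix of size `N + 1 > 0` is zero.
    · unfold minor
      have hz : (Matrix.of fun i m => (M.shift j₀ κ x).y (some ⟨⟨j, p⟩, hp⟩)
          (Function.update (c m) w (a i))) = 0 := by
        ext i m
        exact M.y_eq_zero _ _ fun h => hpi (partialInjective_of_glue h.of_comp)
      exact (congrArg Matrix.det hz).trans Matrix.det_zero

variable {j₀ : J} {S₀ T : Type}

variable (K j₀) in
open scoped Classical in
/-- The entry of the shifted tensors with given indices. -/
noncomputable def entry {j : J} (f : W j → S₀ ⊕ T) :
    MvPolynomial (TensorVar (shiftShape W j₀ S₀) T) K :=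
  if h : j = j₀ ∧ ∀ v, leftPart f v = none then 0
  else MvPolynomial.X ⟨some ⟨⟨j, leftPart f⟩, h⟩, rightPart f⟩

/-- Evaluation at the shifted tensors. -/
noncomputable def shiftEval (M : TensorPoint K W) {T' : Type} (κ : S₀ ⊕ T' → M.S) (x : M.Ω)
    (σ : T → T') : MvPolynomial (TensorVar (shiftShape W j₀ S₀) T) K →+* M.Ω :=
  (M.shift j₀ κ x).eval (T := T) σ

theorem shiftEval_bind₁ (M : TensorPoint K W) {T' : Type} (κ : S₀ ⊕ T' → M.S) (x : M.Ω)
    (σ : T → T') {ι : Type*} (g : ι → MvPolynomial (TensorVar (shiftShape W j₀ S₀) T) K)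
    (F : MvPolynomial ι K) : M.shiftEval κ x σ (MvPolynomial.bind₁ g F) =
      MvPolynomial.eval₂Hom M.coeff (fun v => M.shiftEval κ x σ (g v)) F :=
  MvPolynomial.eval₂Hom_bind₁ _ _ _ _

theorem eval_entry (M : TensorPoint K W) {T' : Type} (κ : S₀ ⊕ T' → M.S) (x : M.Ω) {j : J}
    (f : W j → S₀ ⊕ T) (σ : T → T') (h : ¬ (j = j₀ ∧ ∀ v, leftPart f v = none)) :
    M.shiftEval κ x σ (entry K j₀ f) = M.y j (κ ∘ Sum.map id σ ∘ f) := by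
  rw [entry, dif_neg h, ← glue_leftPart]
  exact MvPolynomial.eval₂Hom_X' _ _ _

variable (K) in
/-- The additional scalar of the shifted tensors. -/
noncomputable def scalar : MvPolynomial (TensorVar (shiftShape W j₀ S₀) T) K :=
  MvPolynomial.X ⟨none, fun v => v.elim⟩

theorem eval_scalar (M : TensorPoint K W) {T' : Type} (κ : S₀ ⊕ T' → M.S) (x : M.Ω)
    (σ : T → T') : M.shiftEval (j₀ := j₀) κ x σ (scalar K) = x :=
  MvPolynomial.eval₂Hom_X' _ _ _

variable (K) in
open scoped Classical in
/-- The expression of the entries of the eliminated tensor in the shifted tensors. -/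
noncomputable def elimination {r : ℕ} (w : W j₀) (a : Fin r → S₀) (c : Fin r → W j₀ → S₀)
    (f : W j₀ → S₀ ⊕ T) : MvPolynomial (TensorVar (shiftShape W j₀ S₀) T) K :=
  ∑ m, ∑ i, entry K j₀ (Function.update (Sum.inl ∘ c m) w (f w)) *
    -- The scalar stands for the inverse of the minor, so that its product with the adjugate is the
    -- inverse matrix and the expression stays polynomial.
    (scalar K * (Matrix.of fun i m => entry K j₀ (T := T)
      (Sum.inl ∘ Function.update (c m) w (a i))).adjugate m i) *
    entry K j₀ (Function.update f w (Sum.inl (a i)))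

-- This is `y_eq_sum` read in the shifted tensors. Arity at least two is essential: the position `v₀
-- ≠ w` keeps an index in `S₀` when the index at `w` of a column is replaced, so no eliminated entry
-- occurs on the right.
open scoped Classical in
theorem eval_elimination (M : TensorPoint K W) {T' : Type} (κ : S₀ ⊕ T' → M.S)
    (hκ : Function.Injective κ) {r : ℕ} {w v₀ : W j₀} (hv₀ : v₀ ≠ w) (a : Fin r → S₀)
    (c : Fin r → W j₀ → S₀) (hac : AdmissibleMinor w a c)
    (hv : M.VanishingMinors j₀ w (r + 1))
    (hm : M.minor j₀ w (fun i => κ (Sum.inl (a i))) (fun m => κ ∘ Sum.inl ∘ c m) ≠ 0)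
    (σ : T → T') (hσ : Function.Injective σ) (f : W j₀ → S₀ ⊕ T) (hf : Function.Injective f)
    (hleft : ∀ v, leftPart f v = none) :
    M.shiftEval κ (M.minor j₀ w (fun i => κ (Sum.inl (a i))) (fun m => κ ∘ Sum.inl ∘ c m))⁻¹ σ
      (elimination K w a c f) = M.y j₀ (κ ∘ Sum.map id σ ∘ f) := by
  have hg : Function.Injective (κ ∘ Sum.map id σ) :=
    hκ.comp (Sum.map_injective.mpr ⟨Function.injective_id, hσ⟩)
  have hne : ∀ v s, f v ≠ Sum.inl s := fun v s h => by
    have := hleft v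
    simp [leftPart, h] at this
  have hne' : ∀ v s, (κ ∘ Sum.map id σ ∘ f) v ≠ κ (Sum.inl s) := fun v s h => by
    refine hne v s (hg (a₂ := Sum.inl s) ?_)
    simpa using h
  have hadm : AdmissibleMinor w (fun i => κ (Sum.inl (a i))) (fun m => κ ∘ Sum.inl ∘ c m) := by
    intro i m
    have := (hκ.comp Sum.inl_injective).comp (hac i m)
    rw [Function.comp_update] at this
    exact this
  rw [y_eq_sum M hv _ _ hm hadm (κ ∘ Sum.map id σ ∘ f) (hg.comp hf) (fun v i => hne' v _) (fun v m v' _ => hne' v _)]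
  simp only [elimination, map_sum, map_mul]
  refine Finset.sum_congr rfl fun m _ => Finset.sum_congr rfl fun i _ => ?_
  congr 1
  · congr 1
    · rw [eval_entry]
      · congr 1
        rw [Function.comp_update, Function.comp_update]
        rfl
      · intro h
        have := h.2 v₀
        simp [leftPart, Function.update_of_ne hv₀] at this
    · rw [eval_scalar]
      congr 1
      rw [← Matrix.map_apply (f := M.shiftEval κ _ σ), ← RingHom.mapMatrix_apply, RingHom.map_adjugate]
      refine congrArg (fun A : Matrix _ _ M.Ω => A.adjugate m i) ?_
      ext i m
      simp only [RingHom.mapMatrix_apply, Matrix.map_apply, Matrix.of_apply]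
      rw [eval_entry]
      · congr 1
        funext v
        by_cases hvw : v = w
        · subst hvw; simp
        · simp [hvw]
      · intro h
        have := h.2 v₀
        simp [leftPart] at this
  · rw [eval_entry]
    · congr 1
      rw [Function.comp_update, Function.comp_update]
      rfl
    · intro h
      have := h.2 w
      simp [leftPart] at this

variable (K) in
open scoped Classical in
/-- The substitution that expresses the entries of tensors in the shifted tensors. -/
noncomputable def shiftSubst {r : ℕ} (w : W j₀) (a : Fin r → S₀) (c : Fin r → W j₀ → S₀)
    {R : Type} (θ : R → S₀ ⊕ T) (v : TensorVar W R) :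
    MvPolynomial (TensorVar (shiftShape W j₀ S₀) T) K :=
  if Function.Injective (θ ∘ v.2) then
    if h : v.1 = j₀ ∧ ∀ i, leftPart (θ ∘ v.2) i = none then
      elimination K w a c fun i => θ (v.2 (cast (congrArg W h.1.symm) i))
    else entry K j₀ (θ ∘ v.2)
  else 0

theorem eval_shiftSubst (M : TensorPoint K W) {T' : Type} (κ : S₀ ⊕ T' → M.S)
    (hκ : Function.Injective κ) {r : ℕ} {w v₀ : W j₀} (hv₀ : v₀ ≠ w) (a : Fin r → S₀)
    (c : Fin r → W j₀ → S₀) (hac : AdmissibleMinor w a c)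
    (hv : M.VanishingMinors j₀ w (r + 1))
    (hm : M.minor j₀ w (fun i => κ (Sum.inl (a i))) (fun m => κ ∘ Sum.inl ∘ c m) ≠ 0)
    (σ : T → T') (hσ : Function.Injective σ) {R : Type} (θ : R → S₀ ⊕ T)
    (F : MvPolynomial (TensorVar W R) K) :
    M.shiftEval κ (M.minor j₀ w (fun i => κ (Sum.inl (a i))) (fun m => κ ∘ Sum.inl ∘ c m))⁻¹ σ
      (MvPolynomial.bind₁ (shiftSubst K w a c θ) F) =
      M.eval (κ ∘ Sum.map id σ ∘ θ) F := by
  have hg : Function.Injective (κ ∘ Sum.map id σ) :=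
    hκ.comp (Sum.map_injective.mpr ⟨Function.injective_id, hσ⟩)
  rw [shiftEval_bind₁, eval]
  refine congrArg (fun g => MvPolynomial.eval₂Hom M.coeff g F) ?_
  funext ⟨j, f⟩
  unfold shiftSubst
  split_ifs with h₁ h₂
  · obtain ⟨rfl, h₂⟩ := h₂
    exact eval_elimination M κ hκ hv₀ a c hac hv hm σ hσ (θ ∘ f) h₁ h₂
  · exact eval_entry M κ _ _ σ h₂
  · rw [map_zero, M.y_eq_zero]
    exact fun h => h₁ (Function.Injective.of_comp (f := κ ∘ Sum.map id σ) h)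

end TensorPoint

/-! ### Noetherianity of bounded rank by induction on rank and on shapes. -/

namespace TensorPoint

variable {K : Type u} [CommRing K] {J : Type} {W : J → Type}

/-- The points of rank at most `N` such that the flattening of `y j₀` along `w` has rank `r`, with
a non-zero minor whose indices form a set identified with `S₀`. -/
def exactRankClass (K : Type u) [CommRing K] {J : Type} (W : J → Type) (N : ℕ) {j₀ : J} (w : W j₀)
    {S₀ : Type} {r : ℕ} (a : Fin r → S₀)
    (c : Fin r → W j₀ → S₀) : Set (TensorPoint K W) :=
  {M | M ∈ rankClass K W N ∧ M.VanishingMinors j₀ w (r + 1) ∧ ∃ ι : S₀ → M.S,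
    Function.Injective ι ∧ M.minor j₀ w (ι ∘ a) (fun m => ι ∘ c m) ≠ 0}

/-- A point of the class is recovered from its shift along the indices of a non-zero minor. An
equation on it becomes a family of equations on the shift, one for each way of placing its indices
in `S₀` or outside. -/
theorem isNoeth_exactRankClass {N : ℕ} {j₀ : J} {w v₀ : W j₀} (hv₀ : v₀ ≠ w) {S₀ : Type} {r : ℕ}
    (a : Fin r → S₀) (c : Fin r → W j₀ → S₀) (hac : AdmissibleMinor w a c)
    (h : IsNoeth (rankClass K (shiftShape W j₀ S₀) N)) :
    IsNoeth (exactRankClass K W N w a c) := by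
  classical
  refine h.of_translation (fun F => {G | ∃ (T : FI) (θ : F.1.carrier → S₀ ⊕ T.carrier),
    Function.Injective θ ∧ G = ⟨T, MvPolynomial.bind₁ (shiftSubst K w a c θ) F.2⟩}) ?_
  rintro M ⟨hM, hv, ι, hι, hm⟩
  let κ : S₀ ⊕ {s : M.S // s ∉ Set.range ι} → M.S := Sum.elim ι Subtype.val
  have hκ : Function.Injective κ :=
    hι.sumElim Subtype.val_injective fun s t e => t.2 ⟨s, e⟩
  refine ⟨M.shift j₀ κ (M.minor j₀ w (fun i => κ (Sum.inl (a i))) (fun m => κ ∘ Sum.inl ∘ c m))⁻¹,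
    shift_mem_rankClass hM j₀ κ hκ _, fun F => ⟨?_, ?_⟩⟩
  · rintro hF _ ⟨T, θ, hθ, rfl⟩ σ hσ
    refine (eval_shiftSubst M κ hκ hv₀ a c hac hv hm σ hσ θ F.2).trans (hF _ ?_)
    exact hκ.comp ((Sum.map_injective.mpr ⟨Function.injective_id, hσ⟩).comp hθ)
  · intro hF σ hσ
    have := F.1.finite
    -- An injection `σ` splits the index set of the equation: `T` consists of the elements sent
    -- outside the copy of `S₀`, and `θ` records the positions of the others.
    let T : FI := FI.of {t : F.1.carrier // σ t ∉ Set.range ι}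
    let θ : F.1.carrier → S₀ ⊕ T.carrier := fun t =>
      if h : σ t ∈ Set.range ι then Sum.inl h.choose else Sum.inr ⟨t, h⟩
    let σ' : T.carrier → {s : M.S // s ∉ Set.range ι} := fun t => ⟨σ t.1, t.2⟩
    have hσ' : Function.Injective σ' := fun t t' e =>
      Subtype.ext (hσ (congrArg Subtype.val e))
    have hcomp : κ ∘ Sum.map id σ' ∘ θ = σ := by
      funext t
      by_cases h : σ t ∈ Set.range ι
      · simp only [Function.comp_apply, θ, dif_pos h]
        exact h.choose_spec
      · simp only [Function.comp_apply, θ, dif_neg h]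
        rfl
    have hθ : Function.Injective θ := by
      rw [← hcomp] at hσ
      exact hσ.of_comp.of_comp
    have := hF _ ⟨T, θ, hθ, rfl⟩ σ' hσ'
    rw [← hcomp, ← eval_shiftSubst M κ hκ hv₀ a c hac hv hm σ' hσ' θ F.2]
    exact this

/-- The rows and columns of a minor, up to renaming of indices: an equivalence relation that tells
which of the indices coincide. -/
abbrev MinorPattern (V : Type) (r : ℕ) := Setoid (Fin r ⊕ Fin r × V)

namespace MinorPattern

variable {V : Type} {r : ℕ}

instance [Finite V] : Finite (MinorPattern V r) :=
  Finite.of_injective (fun s : MinorPattern V r => s.r) fun s t h => Setoid.ext fun a b => by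
    exact iff_of_eq (congrFun (congrFun h a) b)

/-- The universal rows with given pattern. -/
def row (s : MinorPattern V r) (i : Fin r) : Quotient s := Quotient.mk s (Sum.inl i)

/-- The universal columns with given pattern. -/
def col (s : MinorPattern V r) (m : Fin r) (v : V) : Quotient s := Quotient.mk s (Sum.inr (m, v))

/-- Indices are identified exactly when they coincide in `S`. For fixed `r` and finite `V` there are
finitely many patterns, so finitely many sets `S₀` account for all non-zero minors. -/
theorem exists_eq_comp {S : Type} (a : Fin r → S) (c : Fin r → V → S) :
    ∃ (s : MinorPattern V r) (ι : Quotient s → S), Function.Injective ι ∧ ι ∘ s.row = a ∧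
      (fun m => ι ∘ s.col m) = c :=
  ⟨Setoid.ker (Sum.elim a fun p => c p.1 p.2), Setoid.kerLift _, Setoid.kerLift_injective _,
    rfl, rfl⟩

end MinorPattern

theorem AdmissibleMinor.of_comp {V S S' : Type} {w : V} {κ : Type} {a : κ → S}
    {c : κ → V → S} {ι : S → S'} (h : AdmissibleMinor w (ι ∘ a) (fun m => ι ∘ c m)) :
    AdmissibleMinor w a c := by
  classical
  intro i m
  have := h i m
  simp only [Function.comp_apply] at this
  rw [← Function.comp_update] at this
  exact this.of_comp

/-- Induction on `r`: if the minors of size `r + 1` vanish, either those of size `r` vanish too, or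
one of finitely many patterns carries a non-zero minor of size `r`. The bound `N` then gives the
whole class at `r = N + 1`. -/
theorem isNoeth_rankClass_of_shift [∀ j, Finite (W j)] {N : ℕ} {j₀ : J} {w v₀ : W j₀}
    (hv₀ : v₀ ≠ w)
    (h : ∀ (S₀ : Type) [Finite S₀], IsNoeth (rankClass K (shiftShape W j₀ S₀) N)) :
    IsNoeth (rankClass K W N) := by
  have key : ∀ r, IsNoeth {M | M ∈ rankClass K W N ∧ M.VanishingMinors j₀ w r} := by
    intro r
    induction r with
    | zero => exact IsNoeth.empty.mono fun M hM => not_vanishingMinors_zero M j₀ w hM.2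
    | succ r ih =>
      have h₁ : ∀ s : MinorPattern (W j₀) r,
          IsNoeth {M | AdmissibleMinor w s.row s.col ∧
            M ∈ exactRankClass K W N w s.row s.col} := by
        intro s
        by_cases hs : AdmissibleMinor w s.row s.col
        · exact (isNoeth_exactRankClass hv₀ _ _ hs (h _)).mono fun M hM => hM.2
        · exact IsNoeth.empty.mono fun M hM => hs hM.1
      refine (ih.union (IsNoeth.iUnion h₁)).mono ?_
      rintro M ⟨hM, hr⟩
      by_cases hv : M.VanishingMinors j₀ w r
      · exact Or.inl ⟨hM, hv⟩
      · right
        unfold VanishingMinors at hv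
        push Not at hv
        obtain ⟨a, c, hac, hne⟩ := hv
        obtain ⟨s, ι, hι, rfl, rfl⟩ := MinorPattern.exists_eq_comp a c
        have hmem : M ∈ exactRankClass K W N w s.row s.col := ⟨hM, hr, ι, hι, hne⟩
        exact Set.mem_iUnion_of_mem s ⟨hac.of_comp, hmem⟩
  exact (key (N + 1)).mono fun M hM => And.intro hM (hM j₀ w)

instance [∀ j, Finite (W j)] (j₀ : J) (S₀ : Type) (j) : Finite (shiftShape W j₀ S₀ j) := by
  rcases j with _ | p
  · exact inferInstanceAs (Finite Empty)
  · exact inferInstanceAs (Finite {v // p.1.2 v = none})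

theorem card_shiftShape_le [∀ j, Finite (W j)] {d : ℕ} (hd : ∀ j, Nat.card (W j) ≤ d) (j₀ : J)
    (S₀ : Type) (j) : Nat.card (shiftShape W j₀ S₀ j) ≤ d := by
  rcases j with _ | p
  · exact (Nat.card_of_isEmpty (α := Empty)).trans_le (Nat.zero_le d)
  · exact (Finite.card_subtype_le _).trans (hd p.1.1)

/-- A shifted tensor keeps arity `d` only if no index is fixed, so it is one of the original tensors
other than `j₀`. The condition `d ≠ 0` excludes the additional scalar. -/
theorem card_shiftShape_max_lt [Finite J] [∀ j, Finite (W j)] {d : ℕ} (hd : ∀ j, Nat.card (W j) ≤ d)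
    (hd0 : d ≠ 0) {j₀ : J} (hj₀ : Nat.card (W j₀) = d) (S₀ : Type) :
    Nat.card {j // Nat.card (shiftShape W j₀ S₀ j) = d} < Nat.card {j // Nat.card (W j) = d} := by
  have key : ∀ j : ShiftIndex W j₀ S₀, Nat.card (shiftShape W j₀ S₀ j) = d →
      ∃ p, j = some p ∧ Nat.card (W p.1.1) = d ∧ p.1.2 = (fun _ => none) := by
    rintro (_ | p) h
    · exact (hd0 (h.symm.trans (Nat.card_of_isEmpty (α := Empty)))).elim
    · have h' : Nat.card {v // p.1.2 v = none} = d := h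
      have hle := (Finite.card_subtype_le (fun v => p.1.2 v = none))
      refine ⟨p, rfl, le_antisymm (hd _) (h' ▸ hle), ?_⟩
      by_contra hne
      obtain ⟨v, hv⟩ := Function.ne_iff.mp hne
      have := Finite.card_subtype_lt (p := fun v => p.1.2 v = none) (x := v) hv
      exact absurd (hd p.1.1) (by omega)
  choose p hp hcard hnone using key
  let f : {j // Nat.card (shiftShape W j₀ S₀ j) = d} → {j // Nat.card (W j) = d} :=
    fun j => ⟨(p j.1 j.2).1.1, hcard j.1 j.2⟩
  have hne : ∀ j, f j ≠ ⟨j₀, hj₀⟩ := fun j e =>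
    (p j.1 j.2).2 ⟨congrArg Subtype.val e, fun v => congrFun (hnone j.1 j.2) v⟩
  have hf : Function.Injective f := by
    intro j j' e
    have e' : (p j.1 j.2).1.1 = (p j'.1 j'.2).1.1 := congrArg Subtype.val e
    apply Subtype.ext
    rw [hp j.1 j.2, hp j'.1 j'.2]
    congr 1
    apply Subtype.ext
    refine Sigma.ext e' ?_
    rw [hnone, hnone, e']
  refine (Nat.card_le_card_of_injective
    (β := {j : {j // Nat.card (W j) = d} // j ≠ ⟨j₀, hj₀⟩})
    (fun j => ⟨f j, hne j⟩) fun j j' e => hf (congrArg Subtype.val e)).trans_lt ?_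
  exact Finite.card_subtype_lt (x := ⟨j₀, hj₀⟩) (by simp)

/-- Lexicographic induction on the maximal arity and the number of tensors attaining it; elimination
may create many tensors of smaller arity. -/
theorem isNoeth_rankClass_of_le_one
    (hbase : ∀ {J : Type} [Finite J] {W : J → Type} [∀ j, Finite (W j)],
      (∀ j, Nat.card (W j) ≤ 1) → IsNoeth (Set.univ : Set (TensorPoint K W)))
    (d n : ℕ) : ∀ {J : Type} [Finite J] {W : J → Type} [∀ j, Finite (W j)],
      (∀ j, Nat.card (W j) ≤ d) → Nat.card {j // Nat.card (W j) = d} ≤ n → ∀ N,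
      IsNoeth (rankClass K W N) := by
  induction d generalizing n with
  | zero => exact fun h _ N => (hbase fun j => (h j).trans zero_le_one).mono (Set.subset_univ _)
  | succ d ihd =>
    induction n with
    | zero =>
      intro J _ W _ hd hn N
      refine ihd _ (fun j => ?_) le_rfl N
      have h0 : IsEmpty {j // Nat.card (W j) = d + 1} := by
        rw [← not_nonempty_iff]
        exact fun _ => Nat.card_pos.ne' (Nat.le_zero.mp hn)
      exact Nat.le_of_lt_succ ((hd j).lt_of_ne fun e => h0.elim ⟨j, e⟩)
    | succ n ihn =>
      intro J _ W _ hd hn N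
      rcases Nat.eq_zero_or_pos d with rfl | hdpos
      · exact (hbase hd).mono (Set.subset_univ _)
      by_cases hex : ∃ j₀, Nat.card (W j₀) = d + 1
      · obtain ⟨j₀, hj₀⟩ := hex
        have : Nontrivial (W j₀) := Finite.one_lt_card_iff_nontrivial.mp (by omega)
        obtain ⟨w, v₀, hv₀⟩ := exists_pair_ne (W j₀)
        refine isNoeth_rankClass_of_shift hv₀.symm fun S₀ _ =>
          ihn (card_shiftShape_le hd j₀ S₀) ?_ N
        exact Nat.le_of_lt_succ
          ((card_shiftShape_max_lt hd (Nat.succ_ne_zero d) hj₀ S₀).trans_le hn)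
      · refine ihd _ (fun j => ?_) le_rfl N
        exact Nat.le_of_lt_succ ((hd j).lt_of_ne fun e => hex ⟨j, e⟩)

end TensorPoint

/-! ### Noetherianity of polynomial rings in rows of variables up to increasing maps -/

section LeadingCoefficients

variable {σ τ : Type*} [LinearOrder σ] [LinearOrder τ]

/-- The comparison is decided at the least variable where the exponents differ, and a strictly
increasing map sends it to the least such variable of the images. -/
theorem Finsupp.toLex_mapDomain_lt {f : σ → τ} (hf : StrictMono f) {u v : σ →₀ ℕ}
    (h : toLex u < toLex v) : toLex (u.mapDomain f) < toLex (v.mapDomain f) := by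
  obtain ⟨i, hi, hlt⟩ := Finsupp.Lex.lt_iff.mp h
  refine Finsupp.Lex.lt_iff.mpr ⟨f i, fun j hj => ?_, ?_⟩
  · by_cases hjr : j ∈ Set.range f
    · obtain ⟨j, rfl⟩ := hjr
      simpa [Finsupp.mapDomain_apply hf.injective] using hi j (hf.lt_iff_lt.mp hj)
    · simp [Finsupp.mapDomain_of_notMem_range _ _ hjr]
  · simpa [Finsupp.mapDomain_apply hf.injective] using hlt

variable {R : Type*} [CommRing R]

/-- The ideal of coefficients of the monomial `u` in elements of `I` with leading monomial at
most `u`. -/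
def Ideal.leadIdeal (I : Ideal (MvPolynomial σ R)) (u : σ →₀ ℕ) : Ideal R where
  carrier := {c | ∃ f ∈ I, f.coeff u = c ∧ ∀ v, toLex u < toLex v → f.coeff v = 0}
  zero_mem' := ⟨0, I.zero_mem, by simp⟩
  add_mem' := by
    rintro _ _ ⟨f, hf, rfl, hf'⟩ ⟨g, hg, rfl, hg'⟩
    exact ⟨f + g, I.add_mem hf hg, by simp, fun v hv => by simp [hf' v hv, hg' v hv]⟩
  smul_mem' := by
    rintro a _ ⟨f, hf, rfl, hf'⟩
    exact ⟨MvPolynomial.C a * f, I.mul_mem_left _ hf, by simp, fun v hv => by simp [hf' v hv]⟩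

/-- Renaming by `f` and multiplying by a monomial preserve the order of monomials, hence leading
terms and their coefficients. -/
theorem Ideal.leadIdeal_le_of_mapDomain_le {I : Ideal (MvPolynomial σ R)}
    {I' : Ideal (MvPolynomial τ R)} {f : σ → τ} (hf : StrictMono f)
    (h : ∀ p ∈ I, MvPolynomial.rename f p ∈ I') {u : σ →₀ ℕ} {v : τ →₀ ℕ}
    (huv : u.mapDomain f ≤ v) : I.leadIdeal u ≤ I'.leadIdeal v := by
  rintro _ ⟨p, hp, rfl, hp'⟩
  obtain ⟨s, rfl⟩ := exists_add_of_le huv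
  refine ⟨MvPolynomial.monomial s 1 * MvPolynomial.rename f p, I'.mul_mem_left _ (h p hp), ?_, ?_⟩
  · rw [add_comm, MvPolynomial.coeff_monomial_mul,
      MvPolynomial.coeff_rename_mapDomain f hf.injective, one_mul]
  · intro v hv
    rw [MvPolynomial.coeff_monomial_mul']
    split_ifs with hs
    · obtain ⟨t, rfl⟩ := exists_add_of_le hs
      rw [add_tsub_cancel_left, one_mul]
      refine MvPolynomial.coeff_rename_eq_zero f p t fun u' hu' => hp' u' ?_
      subst hu'
      rw [add_comm, toLex_add, toLex_add] at hv
      have hv' := lt_of_add_lt_add_left hv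
      by_contra hle
      rcases (not_lt.mp hle).lt_or_eq with hlt | heq
      · exact lt_asymm hv' (Finsupp.toLex_mapDomain_lt hf hlt)
      · rw [toLex_inj.mp heq] at hv'
        exact lt_irrefl _ hv'
    · rfl

/-- Division with remainder: subtracting an element of `I'` with the same leading term lowers the
leading monomial. This stops because the lexicographic order in finitely many variables is a
well-order. -/
theorem Ideal.le_of_leadIdeal_le [Finite σ] {I I' : Ideal (MvPolynomial σ R)} (hle : I' ≤ I)
    (h : ∀ u, I.leadIdeal u ≤ I'.leadIdeal u) : I ≤ I' := by
  have key : ∀ u : Lex (σ →₀ ℕ), ∀ f ∈ I, (∀ v, u < toLex v → f.coeff v = 0) → f ∈ I' := by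
    intro u
    induction u using WellFoundedLT.induction with
    | ind u ih =>
      intro f hf hfu
      obtain ⟨g, hg, hgu, hg'⟩ := h (ofLex u) ⟨f, hf, rfl, hfu⟩
      suffices f - g ∈ I' by simpa using I'.add_mem this hg
      by_cases h0 : f - g = 0
      · rw [h0]; exact I'.zero_mem
      · obtain ⟨v, hv, hmax⟩ := Finset.exists_max_image (f - g).support toLex
          (Finset.nonempty_of_ne_empty (by simpa using h0))
        refine ih (toLex v) ?_ _ (I.sub_mem hf (hle hg)) fun v' hv' => ?_
        · rw [MvPolynomial.mem_support_iff] at hv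
          by_contra hlt
          apply hv
          rcases (not_lt.mp hlt).lt_or_eq with hlt | heq
          · simp [hfu v hlt, hg' v hlt]
          · rw [MvPolynomial.coeff_sub, ← ofLex_toLex v, ← heq, hgu, sub_self]
        · by_contra hne
          exact absurd hv' (not_lt.mpr (hmax v' (MvPolynomial.mem_support_iff.mpr hne)))
  intro f hf
  by_cases h0 : f = 0
  · rw [h0]; exact I'.zero_mem
  · obtain ⟨v, -, hmax⟩ := Finset.exists_max_image f.support toLex
      (Finset.nonempty_of_ne_empty (by simpa using h0))
    refine key (toLex v) f hf fun v' hv' => ?_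
    by_contra hne
    exact absurd hv' (not_lt.mpr (hmax v' (MvPolynomial.mem_support_iff.mpr hne)))

end LeadingCoefficients

/-- The variables in `n` rows of length `k`. -/
abbrev RowVar (k n : ℕ) := Fin n ×ₗ Fin k

/-- The map of variables that maps rows by `o`. -/
def RowVar.map {k m n : ℕ} (o : Fin m → Fin n) (p : RowVar k m) : RowVar k n :=
  toLex (o (ofLex p).1, (ofLex p).2)

theorem RowVar.map_strictMono {k m n : ℕ} {o : Fin m → Fin n} (ho : StrictMono o) :
    StrictMono (RowVar.map (k := k) o) := by
  intro p q h
  rw [Prod.Lex.lt_iff] at h ⊢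
  rcases h with h | ⟨h, h'⟩
  · exact Or.inl (ho h)
  · exact Or.inr ⟨congrArg o h, h'⟩

/-- Divisibility of monomials up to increasing maps. -/
def RowVar.Divides {k : ℕ} (u v : Σ n, (RowVar k n →₀ ℕ)) : Prop :=
  ∃ o : Fin u.1 ↪o Fin v.1, u.2.mapDomain (RowVar.map o) ≤ v.2

theorem RowVar.divides_of_sublistForall₂ {k : ℕ} {u v : Σ n, (RowVar k n →₀ ℕ)}
    (h : List.SublistForall₂ (· ≤ ·) (List.ofFn fun i (a : Fin k) => u.2 (toLex (i, a)))
      (List.ofFn fun i (a : Fin k) => v.2 (toLex (i, a)))) : RowVar.Divides u v := by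
  obtain ⟨l, hl, hsub⟩ := List.sublistForall₂_iff.mp h
  obtain ⟨o, ho⟩ := List.sublist_iff_exists_fin_orderEmbedding_get_eq.mp hsub
  have hlen : l.length = u.1 := by simpa using hl.length_eq.symm
  let o' : Fin u.1 ↪o Fin v.1 :=
    ((Fin.castOrderIso hlen.symm).toOrderEmbedding.trans o).trans
      (Fin.castOrderIso (by simp)).toOrderEmbedding
  have hle : ∀ i a, u.2 (toLex (i, a)) ≤ v.2 (toLex (o' i, a)) := by
    intro i a
    have h₁ := hl.get (i := i) (by simp) (by rw [hlen]; exact i.2)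
    have h₂ := ho ⟨i, by rw [hlen]; exact i.2⟩
    simp only [List.get_eq_getElem] at h₁ h₂
    rw [h₂] at h₁
    simp only [List.getElem_ofFn] at h₁
    exact h₁ a
  refine ⟨o', fun p => ?_⟩
  by_cases hp : p ∈ Set.range (RowVar.map o')
  · obtain ⟨q, rfl⟩ := hp
    rw [Finsupp.mapDomain_apply (RowVar.map_strictMono o'.strictMono).injective]
    exact hle (ofLex q).1 (ofLex q).2
  · rw [Finsupp.mapDomain_of_notMem_range _ _ hp]
    exact Nat.zero_le _

/-- A monomial is a word whose letters are the exponent vectors of its rows. Letters are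
well-quasi-ordered by Dickson's lemma, hence words by Higman's lemma. -/
theorem RowVar.exists_divides_subseq {k : ℕ} (u : ℕ → Σ n, (RowVar k n →₀ ℕ)) :
    ∃ g : ℕ ↪o ℕ, ∀ m n, m ≤ n → RowVar.Divides (u (g m)) (u (g n)) := by
  have h := Set.PartiallyWellOrderedOn.partiallyWellOrderedOn_sublistForall₂
    (α := Fin k → ℕ) (· ≤ ·) (Set.partiallyWellOrderedOn_of_wellQuasiOrdered
      wellQuasiOrdered_le Set.univ)
  have : IsPreorder (List (Fin k → ℕ)) (List.SublistForall₂ (· ≤ ·)) :=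
    { refl := Std.Refl.refl, trans := fun _ _ _ => _root_.trans }
  obtain ⟨g, hg⟩ := h.exists_monotone_subseq
    (f := fun n => List.ofFn fun i (a : Fin k) => (u n).2 (toLex (i, a))) (by simp)
  exact ⟨g, fun m n hmn => RowVar.divides_of_sublistForall₂ (hg m n hmn)⟩

/-- Families of ideals in polynomial rings in rows of variables preserved by increasing maps. -/
structure RowIdeal (k : ℕ) (R : Type*) [CommRing R] where
  obj : ∀ n, Ideal (MvPolynomial (RowVar k n) R)
  map_mem : ∀ {m n} (o : Fin m → Fin n), StrictMono o → ∀ p ∈ obj m,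
    MvPolynomial.rename (RowVar.map o) p ∈ obj n

namespace RowIdeal

variable {k : ℕ} {R : Type*} [CommRing R]

theorem leadIdeal_mono (I : RowIdeal k R) {u v : Σ n, (RowVar k n →₀ ℕ)}
    (h : RowVar.Divides u v) : (I.obj u.1).leadIdeal u.2 ≤ (I.obj v.1).leadIdeal v.2 := by
  obtain ⟨o, ho⟩ := h
  exact Ideal.leadIdeal_le_of_mapDomain_le (RowVar.map_strictMono o.strictMono)
    (I.map_mem o o.strictMono) ho

/-- Otherwise there is an infinite sequence in which, whenever an earlier monomial divides a later
one, the lead ideal grows strictly. A divisibility chain inside it contradicts the Noetherianity of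
`R`. -/
theorem exists_finset_leadIdeal [IsNoetherianRing R] (I : RowIdeal k R) :
    ∃ U : Finset (Σ n, (RowVar k n →₀ ℕ)), ∀ v, ∃ u ∈ U, RowVar.Divides u v ∧
      (I.obj v.1).leadIdeal v.2 ≤ (I.obj u.1).leadIdeal u.2 := by
  by_contra! hcon
  obtain ⟨f, -, hf⟩ := exists_seq_of_forall_finset_exists (fun _ => True)
    (fun u v => RowVar.Divides u v → ¬ (I.obj v.1).leadIdeal v.2 ≤ (I.obj u.1).leadIdeal u.2)
    (fun s _ => by obtain ⟨v, hv⟩ := hcon s; exact ⟨v, trivial, hv⟩)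
  obtain ⟨g, hg⟩ := RowVar.exists_divides_subseq f
  obtain ⟨n, hn⟩ := monotone_stabilizes_iff_noetherian.mpr (inferInstance : IsNoetherian R R)
    ⟨fun n => (I.obj (f (g n)).1).leadIdeal (f (g n)).2, fun m n hmn => I.leadIdeal_mono (hg m n hmn)⟩
  exact hf _ _ (g.strictMono n.lt_succ_self) (hg _ _ n.le_succ) (hn (n + 1) n.le_succ).ge

/-- The family of ideals generated by the images of elements of `E` under injections. -/
noncomputable def gen (E : Set (Σ n, MvPolynomial (RowVar k n) R)) : RowIdeal k R where
  -- All injections are used, as in the satisfaction of equations; stability under increasing maps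
  -- is what the leading term argument needs.
  obj n := Ideal.span {p | ∃ q ∈ E, ∃ o : Fin q.1 → Fin n, Function.Injective o ∧
    MvPolynomial.rename (RowVar.map o) q.2 = p}
  map_mem {m n} o ho p hp := by
    rw [← Ideal.mem_comap (f := MvPolynomial.rename (RowVar.map o))]
    revert p
    change _ ≤ Ideal.comap _ _
    rw [Ideal.span_le]
    rintro _ ⟨q, hq, o', ho', rfl⟩
    refine Ideal.subset_span ⟨q, hq, o ∘ o', ho.injective.comp ho', ?_⟩
    rw [MvPolynomial.rename_rename]
    rfl

theorem gen_mono {E E' : Set (Σ n, MvPolynomial (RowVar k n) R)} (h : E ⊆ E') (n : ℕ) :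
    (gen E).obj n ≤ (gen E').obj n :=
  Ideal.span_mono fun _ ⟨q, hq, hq'⟩ => ⟨q, h hq, hq'⟩

theorem exists_finite_mem_gen {E : Set (Σ n, MvPolynomial (RowVar k n) R)} {n : ℕ}
    {p : MvPolynomial (RowVar k n) R} (hp : p ∈ (gen E).obj n) :
    ∃ E₀ ⊆ E, E₀.Finite ∧ p ∈ (gen E₀).obj n := by
  induction hp using Submodule.span_induction with
  | mem p h =>
    obtain ⟨q, hq, h⟩ := h
    exact ⟨{q}, by simpa using hq, Set.finite_singleton q, Ideal.subset_span ⟨q, rfl, h⟩⟩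
  | zero => exact ⟨∅, Set.empty_subset _, Set.finite_empty, Ideal.zero_mem _⟩
  | add p q _ _ hp hq =>
    obtain ⟨E₁, h₁, f₁, hp⟩ := hp
    obtain ⟨E₂, h₂, f₂, hq⟩ := hq
    exact ⟨E₁ ∪ E₂, Set.union_subset h₁ h₂, f₁.union f₂, Ideal.add_mem _
      (gen_mono Set.subset_union_left n hp) (gen_mono Set.subset_union_right n hq)⟩
  | smul a p _ hp =>
    obtain ⟨E₁, h₁, f₁, hp⟩ := hp
    exact ⟨E₁, h₁, f₁, Ideal.mul_mem_left _ a hp⟩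

/-- Finitely many lead ideals control all others. Each has finitely many generators, and each
generator comes from an element that involves finitely many members of `E`. -/
theorem exists_finite_gen_eq [IsNoetherianRing R] (E : Set (Σ n, MvPolynomial (RowVar k n) R)) :
    ∃ E₀ ⊆ E, E₀.Finite ∧ ∀ n, (gen E).obj n ≤ (gen E₀).obj n := by
  obtain ⟨U, hU⟩ := exists_finset_leadIdeal (gen E)
  have h₁ : ∀ u : Σ n, (RowVar k n →₀ ℕ), ∃ E₀ ⊆ E, E₀.Finite ∧
      ((gen E).obj u.1).leadIdeal u.2 ≤ ((gen E₀).obj u.1).leadIdeal u.2 := by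
    intro u
    obtain ⟨s, hs⟩ := IsNoetherian.noetherian (((gen E).obj u.1).leadIdeal u.2)
    have h₂ : ∀ c : s, ∃ E₀ ⊆ E, E₀.Finite ∧ c.1 ∈ ((gen E₀).obj u.1).leadIdeal u.2 := by
      intro c
      have hc : c.1 ∈ ((gen E).obj u.1).leadIdeal u.2 := hs ▸ Submodule.subset_span c.2
      obtain ⟨p, hp, hpc, hp'⟩ := hc
      obtain ⟨E₀, h₀, hf, hpE⟩ := exists_finite_mem_gen hp
      exact ⟨E₀, h₀, hf, p, hpE, hpc, hp'⟩
    choose E₀ h₀ hf hc using h₂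
    refine ⟨⋃ c, E₀ c, Set.iUnion_subset h₀, Set.finite_iUnion hf, ?_⟩
    rw [← hs, Submodule.span_le]
    intro c hcs
    obtain ⟨p, hp, hpc⟩ := hc ⟨c, hcs⟩
    exact ⟨p, gen_mono (Set.subset_iUnion E₀ ⟨c, hcs⟩) _ hp, hpc⟩
  choose E₀ h₀ hf hle using h₁
  refine ⟨⋃ u ∈ U, E₀ u, Set.iUnion₂_subset fun u _ => h₀ u,
    U.finite_toSet.biUnion fun u _ => hf u, fun n => ?_⟩
  refine Ideal.le_of_leadIdeal_le (gen_mono (Set.iUnion₂_subset fun u _ => h₀ u) n) fun v => ?_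
  obtain ⟨u, hu, hdiv, hvu⟩ := hU ⟨n, v⟩
  refine hvu.trans ((hle u).trans (le_trans ?_ ((gen _).leadIdeal_mono hdiv)))
  rintro _ ⟨p, hp, hpc⟩
  exact ⟨p, gen_mono (Set.subset_biUnion_of_mem (u := E₀) hu) _ hp, hpc⟩

end RowIdeal

namespace TensorPoint

variable {K : Type u} [CommRing K] {J : Type} {W : J → Type}

/-! ### Tensors with at most one index -/

section Rows

variable {k : ℕ} (eJ : J ≃ Fin k)

variable (K) in
open scoped Classical in
/-- Polynomials in the entries of tensors with at most one index as polynomials in rows of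
variables, over a ring that contains the entries of the tensors without indices. -/
noncomputable def toRow {T : Type} {n : ℕ} (e : T → Fin n) :
    MvPolynomial (TensorVar W T) K →+* MvPolynomial (RowVar k n) (MvPolynomial J K) :=
  MvPolynomial.eval₂Hom (MvPolynomial.C.comp MvPolynomial.C) fun v =>
    if h : Nonempty (W v.1) then MvPolynomial.X (toLex (e (v.2 h.some), eJ v.1))
    else MvPolynomial.C (MvPolynomial.X v.1)

open scoped Classical in
/-- Evaluation of polynomials in rows of variables. -/
noncomputable def rowEval (M : TensorPoint K W) {n : ℕ} (σ : Fin n → M.S) :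
    MvPolynomial (RowVar k n) (MvPolynomial J K) →+* M.Ω :=
  MvPolynomial.eval₂Hom
    (MvPolynomial.eval₂Hom M.coeff fun j =>
      -- Only tensors without indices contribute scalars in `toRow`, so the default value `0` plays
      -- no role.
      if h : Nonempty (W j) then 0 else M.y j fun w => (h ⟨w⟩).elim)
    fun p => M.y (eJ.symm (ofLex p).2) fun _ => σ (ofLex p).1

theorem rowEval_rename (M : TensorPoint K W) {m n : ℕ} (σ : Fin n → M.S) (o : Fin m → Fin n)
    (p : MvPolynomial (RowVar k m) (MvPolynomial J K)) :
    M.rowEval eJ σ (MvPolynomial.rename (RowVar.map o) p) = M.rowEval eJ (σ ∘ o) p :=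
  MvPolynomial.eval₂Hom_rename _ _ _ _

theorem rowEval_toRow (hW : ∀ j, Subsingleton (W j)) (M : TensorPoint K W) {T : Type} {n : ℕ}
    (e : T → Fin n) (σ : Fin n → M.S) (F : MvPolynomial (TensorVar W T) K) :
    M.rowEval eJ σ (toRow K eJ e F) = M.eval (σ ∘ e) F := by
  suffices (M.rowEval eJ σ).comp (toRow K eJ e) = M.eval (σ ∘ e) from DFunLike.congr_fun this F
  refine MvPolynomial.ringHom_ext (fun c => ?_) fun ⟨j, f⟩ => ?_
  · simp [toRow, rowEval, eval]
  · by_cases h : Nonempty (W j)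
    · simp only [toRow, rowEval, eval, RingHom.comp_apply, MvPolynomial.eval₂Hom_X', dif_pos h,
        ofLex_toLex]
      rw [eJ.symm_apply_apply]
      congr 1
      funext w
      rw [Subsingleton.elim h.some w]
      rfl
    · simp only [toRow, rowEval, eval, RingHom.comp_apply, MvPolynomial.eval₂Hom_X', dif_neg h,
        MvPolynomial.eval₂Hom_C]
      congr 1
      funext w
      exact (h ⟨w⟩).elim

end Rows

/-- The vectors form rows of variables, and the scalars are absorbed into the coefficient ring
`MvPolynomial J K`, Noetherian by Hilbert's basis theorem. A point satisfying the finite subsystem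
has the generated ideals in the kernels of its evaluations along injections. -/
theorem isNoeth_univ_of_card_le_one [IsNoetherianRing K] [Finite J] [∀ j, Finite (W j)]
    (hW : ∀ j, Nat.card (W j) ≤ 1) : IsNoeth (Set.univ : Set (TensorPoint K W)) := by
  intro E
  have hW' : ∀ j, Subsingleton (W j) := fun j => Finite.card_le_one_iff_subsingleton.mp (hW j)
  let eJ := Finite.equivFin J
  let tr : TensorEquation K W → Σ n, MvPolynomial (RowVar (Nat.card J) n) (MvPolynomial J K) :=
    fun F => ⟨Nat.card F.1.carrier, toRow K eJ (Finite.equivFin F.1.carrier) F.2⟩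
  obtain ⟨E₀, h₀, hf, hE⟩ := Set.exists_subset_image_finite_and.mp
    (RowIdeal.exists_finite_gen_eq (tr '' E))
  refine ⟨E₀, h₀, hf, fun M _ hM F hF σ hσ => ?_⟩
  let e := Finite.equivFin F.1.carrier
  have hσe : σ = (σ ∘ e.symm) ∘ e := by
    funext t
    simp
  have hmem : (tr F).2 ∈ (RowIdeal.gen (tr '' E)).obj (tr F).1 := by
    refine Ideal.subset_span ⟨tr F, ⟨F, hF, rfl⟩, id, Function.injective_id, ?_⟩
    exact MvPolynomial.rename_id_apply _
  have hker : (RowIdeal.gen (tr '' E₀)).obj (tr F).1 ≤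
      RingHom.ker (M.rowEval eJ (σ ∘ e.symm)) := by
    refine Ideal.span_le.mpr ?_
    rintro _ ⟨_, ⟨G, hG, rfl⟩, o, ho, rfl⟩
    rw [SetLike.mem_coe, RingHom.mem_ker, rowEval_rename]
    refine (rowEval_toRow eJ hW' M _ _ _).trans (hM G hG _ ?_)
    exact ((hσ.comp e.symm.injective).comp ho).comp (Equiv.injective _)
  have := hker (hE _ hmem)
  rw [hσe, ← rowEval_toRow eJ hW']
  exact this

theorem isNoeth_rankClass [IsNoetherianRing K] [Finite J] [∀ j, Finite (W j)] (N : ℕ) :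
    IsNoeth (rankClass K W N) := by
  obtain ⟨d, hd⟩ := (Set.finite_range fun j => Nat.card (W j)).bddAbove
  exact isNoeth_rankClass_of_le_one isNoeth_univ_of_card_le_one d _
    (fun j => hd ⟨j, rfl⟩) le_rfl N

end TensorPoint

theorem Matrix.det_eq_zero_of_sum_range {R : Type*} [CommRing R] {n N : ℕ} (hn : n ≤ N)
    (X : Matrix (Fin (N + 1)) (Fin (N + 1)) R) (α β : Fin (N + 1) → ℕ → R)
    (h : ∀ i m, X i m = ∑ k ∈ Finset.range n, α i k * β m k) : X.det = 0 := by
  -- The sum is padded by zeros to `N + 1` terms, which makes both factors square; the last column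
  -- of the left one is zero since `n ≤ N`.
  have hX : X = (Matrix.of fun i (k : Fin (N + 1)) => if (k : ℕ) < n then α i k else 0) *
      Matrix.of fun (k : Fin (N + 1)) m => β m k := by
    ext i m
    rw [h, Matrix.mul_apply]
    simp only [Matrix.of_apply]
    rw [Fin.sum_univ_eq_sum_range (fun k => (if k < n then α i k else 0) * β m k) (N + 1)]
    rw [← Finset.sum_subset (Finset.range_mono (hn.trans N.le_succ))]
    · exact Finset.sum_congr rfl fun k hk => by rw [if_pos (Finset.mem_range.mp hk)]
    · intro k _ hk
      rw [if_neg (fun h => hk (Finset.mem_range.mpr h)), zero_mul]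
  rw [hX, Matrix.det_mul, Matrix.det_eq_zero_of_column_eq_zero (Fin.last N), zero_mul]
  intro i
  simp [hn]

namespace FIAlgebra

variable {K : Type u} [CommRing K]

theorem map_map_apply (A : FIAlgebra K) {S T R : FI} (f : S ⟶ T) (g : T ⟶ R) (a : A.obj S) :
    (A.map g).hom ((A.map f).hom a) = (A.map (f ≫ g)).hom a := by
  rw [A.map_comp]
  rfl

theorem app_map_apply {B A : FIAlgebra K} (φ : B ⟶ A) {S T : FI} (f : S ⟶ T) (b : B.obj S) :
    (φ.app T).hom ((B.map f).hom b) = (A.map f).hom ((φ.app S).hom b) := by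
  rw [← CommAlgCat.comp_apply, φ.naturality, CommAlgCat.comp_apply]

/-! ### Algebras generated in width at most one -/

theorem IsGeneratedInWidthLE.adjoin_eq_top {A : FIAlgebra K} {d : ℕ}
    (hA : A.IsGeneratedInWidthLE d) (S : FI) :
    Algebra.adjoin K {x : A.obj S | ∃ n ≤ d, ∃ (π : FI.fin n ⟶ S) (a : A.obj (FI.fin n)),
      (A.map π).hom a = x} = ⊤ := by
  obtain ⟨D, hD, hgen⟩ := hA
  refine hgen
    { obj := fun S => Algebra.adjoin K {x : A.obj S | ∃ n ≤ d, ∃ (π : FI.fin n ⟶ S)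
        (a : A.obj (FI.fin n)), (A.map π).hom a = x}
      map_mem := fun {S T} f a ha => ?_ } (fun x hx => ?_) S
  · rw [← Subalgebra.mem_comap]
    revert a
    change Algebra.adjoin K _ ≤ _
    refine Algebra.adjoin_le ?_
    rintro _ ⟨n, hn, π, a, rfl⟩
    refine Algebra.subset_adjoin ⟨n, hn, π ≫ f, a, ?_⟩
    exact (map_map_apply A π f a).symm
  · refine Algebra.subset_adjoin ⟨A.width x, hD x hx, ?_⟩
    exact Nat.sInf_mem (A.width_set_nonempty x)

/-- The inclusion of a subset of a finite set. -/
def inclusion {S : FI} (P : S.carrier → Prop) : FI.of {s // P s} ⟶ S :=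
  Function.Embedding.subtype P

/-- A generator of width at most one comes from a set of at most one element, which is mapped to `w`
or avoids it. So `A(S)` is the product of the images of the algebras of `{w}` and of its complement.
-/
theorem IsGeneratedInWidthLE.exists_eq_sum {A : FIAlgebra K} (hA : A.IsGeneratedInWidthLE 1)
    {S : FI} (w : S.carrier) (g : A.obj S) :
    ∃ (n : ℕ) (u : ℕ → A.obj (FI.of {s // s = w})) (v : ℕ → A.obj (FI.of {s // s ≠ w})),
      g = ∑ k ∈ Finset.range n,
        (A.map (inclusion fun s => s = w)).hom (u k) *
          (A.map (inclusion fun s => s ≠ w)).hom (v k) := by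
  have hle : Algebra.adjoin K {x : A.obj S | ∃ n ≤ 1, ∃ (π : FI.fin n ⟶ S) (a : A.obj (FI.fin n)),
      (A.map π).hom a = x} ≤ (A.map (inclusion fun s => s = w)).hom.range ⊔
        (A.map (inclusion fun s => s ≠ w)).hom.range := by
    refine Algebra.adjoin_le ?_
    rintro _ ⟨n, hn, π, a, rfl⟩
    by_cases h : ∀ i, π.1 i ≠ w
    · let π' : FI.fin n ⟶ FI.of {s // s ≠ w} :=
        ⟨fun i => ⟨π.1 i, h i⟩, fun i j e => π.2 (congrArg Subtype.val e)⟩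
      have hπ : π' ≫ inclusion (fun s => s ≠ w) = π := rfl
      refine (le_sup_right : _ ≤ (A.map (inclusion fun s => s = w)).hom.range ⊔ _)
        ⟨(A.map π').hom a, ?_⟩
      rw [← hπ, ← map_map_apply]
      rfl
    · push Not at h
      obtain ⟨i, hi⟩ := h
      have : Subsingleton (Fin n) := Fin.subsingleton_iff_le_one.mpr hn
      let π' : FI.fin n ⟶ FI.of {s // s = w} :=
        ⟨fun j => ⟨π.1 j, (congrArg π.1 (Subsingleton.elim (α := Fin n) j i)).trans hi⟩,
          fun i j e => π.2 (congrArg Subtype.val e)⟩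
      have hπ : π' ≫ inclusion (fun s => s = w) = π := rfl
      refine (le_sup_left : _ ≤ _ ⊔ (A.map (inclusion fun s => s ≠ w)).hom.range)
        ⟨(A.map π').hom a, ?_⟩
      rw [← hπ, ← map_map_apply]
      rfl
  rw [hA.adjoin_eq_top] at hle
  have hg := hle (show g ∈ (⊤ : Subalgebra K (A.obj S)) from trivial)
  rw [← Subalgebra.mem_toSubmodule, ← Subalgebra.mul_toSubmodule] at hg
  induction hg using Submodule.mul_induction_on' with
  | mem_mul_mem x hx y hy =>
    obtain ⟨x, rfl⟩ := hx
    obtain ⟨y, rfl⟩ := hy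
    exact ⟨1, fun _ => x, fun _ => y, by simp⟩
  | add x _ y _ hx hy =>
    obtain ⟨n, u, v, rfl⟩ := hx
    obtain ⟨n', u', v', rfl⟩ := hy
    refine ⟨n + n', fun k => if k < n then u k else u' (k - n),
      fun k => if k < n then v k else v' (k - n), ?_⟩
    rw [Finset.sum_range_add]
    congr 1
    · exact Finset.sum_congr rfl fun k hk => by simp [Finset.mem_range.mp hk]
    · exact Finset.sum_congr rfl fun k hk => by simp

/-! ### Finitely generated algebras and tensors -/

theorem IsFinitelyGenerated.exists_generators {B : FIAlgebra K} (hB : B.IsFinitelyGenerated) :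
    ∃ (m : ℕ) (d : Fin m → B.Element), B.IsGeneratedBy (Set.range d) := by
  obtain ⟨D, hf, hD⟩ := hB
  obtain ⟨m, e, -, rfl⟩ := hf.fin_param
  exact ⟨m, e, hD⟩

variable {B : FIAlgebra K} {J : Type} (d : J → B.Element)

/-- The shapes of the tensors of images of the elements `d`. -/
abbrev tensorShape (j : J) : Type := (d j).1.carrier

open scoped Classical in
/-- The tensors of images of the elements `d`. -/
noncomputable def tensorEntry (T : FI) (v : TensorVar (tensorShape d) T.carrier) : B.obj T :=
  if h : Function.Injective v.2 then (B.map (X := (d v.1).1) (Y := T) ⟨v.2, h⟩).hom (d v.1).2 else 0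

theorem map_tensorEntry {S T : FI} (f : S ⟶ T) (v : TensorVar (tensorShape d) S.carrier) :
    (B.map f).hom (tensorEntry d S v) = tensorEntry d T ⟨v.1, f.1 ∘ v.2⟩ := by
  unfold tensorEntry
  by_cases h : Function.Injective v.2
  · rw [dif_pos h, dif_pos (f.2.comp h), map_map_apply]
    rfl
  · rw [dif_neg h, dif_neg fun h' => h (Function.Injective.of_comp (f := f.1) h'), map_zero]

/-- The homomorphism that evaluates polynomials at the tensors of images of the elements `d`. -/
noncomputable def polyMap (T : FI) :
    MvPolynomial (TensorVar (tensorShape d) T.carrier) K →ₐ[K] B.obj T :=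
  MvPolynomial.aeval (tensorEntry d T)

theorem map_polyMap {S T : FI} (f : S ⟶ T)
    (F : MvPolynomial (TensorVar (tensorShape d) S.carrier) K) :
    (B.map f).hom (polyMap d S F) =
      MvPolynomial.aeval (fun v => tensorEntry d T ⟨v.1, f.1 ∘ v.2⟩) F := by
  rw [polyMap, ← AlgHom.comp_apply, MvPolynomial.comp_aeval]
  simp only [map_tensorEntry]

theorem polyMap_surjective (hd : B.IsGeneratedBy (Set.range d)) (T : FI) :
    Function.Surjective (polyMap d T) := by
  rw [← AlgHom.range_eq_top]
  refine hd { obj := fun T => (polyMap d T).range, map_mem := ?_ } ?_ T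
  · rintro S T f _ ⟨F, rfl⟩
    refine ⟨MvPolynomial.rename (fun v => ⟨v.1, f.1 ∘ v.2⟩) F, ?_⟩
    refine Eq.trans ?_ (map_polyMap d f F).symm
    exact MvPolynomial.aeval_rename _ _ _
  · rintro _ ⟨j, rfl⟩
    refine ⟨MvPolynomial.X ⟨j, id⟩, ?_⟩
    refine (MvPolynomial.aeval_X _ _).trans ?_
    rw [tensorEntry, dif_pos Function.injective_id]
    exact congrArg (fun f => f.hom (d j).2) (B.map_id (d j).1)

/-- The tensors over the residue field of a prime. -/
noncomputable def tensorPoint {S : FI} (p : PrimeSpectrum (B.obj S)) :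
    TensorPoint K (tensorShape d) where
  S := S.carrier
  Ω := p.asIdeal.ResidueField
  coeff := (algebraMap (B.obj S) p.asIdeal.ResidueField).comp (algebraMap K (B.obj S))
  y j f := algebraMap (B.obj S) p.asIdeal.ResidueField (tensorEntry d S ⟨j, f⟩)
  y_eq_zero j f hf := by rw [tensorEntry, dif_neg hf, map_zero]

theorem eval_tensorPoint {S T : FI} (p : PrimeSpectrum (B.obj S)) (σ : T ⟶ S)
    (F : MvPolynomial (TensorVar (tensorShape d) T.carrier) K) :
    (tensorPoint d p).eval σ.1 F =
      algebraMap (B.obj S) p.asIdeal.ResidueField ((B.map σ).hom (polyMap d T F)) := by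
  rw [map_polyMap]
  suffices (tensorPoint d p).eval σ.1 = (algebraMap (B.obj S) p.asIdeal.ResidueField).comp
    (MvPolynomial.aeval (R := K) (fun v => tensorEntry d S ⟨v.1, σ.1 ∘ v.2⟩)).toRingHom from
    DFunLike.congr_fun this F
  refine MvPolynomial.ringHom_ext (fun c => ?_) fun v => ?_
  · refine (MvPolynomial.eval₂Hom_C _ _ _).trans ?_
    exact congrArg (algebraMap (B.obj S) p.asIdeal.ResidueField)
      (MvPolynomial.aeval_C (R := K) _ c).symm
  · refine (MvPolynomial.eval₂Hom_X' _ _ _).trans ?_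
    exact congrArg (algebraMap (B.obj S) p.asIdeal.ResidueField)
      (MvPolynomial.aeval_X (R := K)
        (fun v => tensorEntry d S ⟨v.1, σ.1 ∘ v.2⟩) v).symm

theorem eval_tensorPoint_eq_zero_iff {S T : FI} (p : PrimeSpectrum (B.obj S)) (σ : T ⟶ S)
    (F : MvPolynomial (TensorVar (tensorShape d) T.carrier) K) :
    (tensorPoint d p).eval σ.1 F = 0 ↔ (B.map σ).hom (polyMap d T F) ∈ p.asIdeal := by
  rw [eval_tensorPoint]
  exact Ideal.algebraMap_residueField_eq_zero

/-- Elements of `B` are lifted to polynomials, so their vanishing at a prime becomes satisfaction of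
equations by its tensors. -/
theorem exists_finite_zeroLocus_subset [IsNoetherianRing K] [Finite J]
    (hd : B.IsGeneratedBy (Set.range d)) (N : ℕ) (E : Set B.Element) :
    ∃ E₀ ⊆ E, E₀.Finite ∧ ∀ (S : FI) (p : PrimeSpectrum (B.obj S)),
      tensorPoint d p ∈ TensorPoint.rankClass K (tensorShape d) N →
        p ∈ B.zeroLocus E₀ S → p ∈ B.zeroLocus E S := by
  choose F hF using fun x : B.Element => polyMap_surjective d hd x.1 x.2
  let tr : B.Element → TensorEquation K (tensorShape d) := fun x => ⟨x.1, F x⟩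
  obtain ⟨E₀, h₀, hf, hE⟩ := Set.exists_subset_image_finite_and.mp
    (TensorPoint.isNoeth_rankClass (K := K) (W := tensorShape d) N (tr '' E))
  refine ⟨E₀, h₀, hf, fun S p hp hpE x hx σ => ?_⟩
  have := hE _ hp ?_ (tr x) ⟨x, hx, rfl⟩ σ.1 σ.2
  · have := (eval_tensorPoint_eq_zero_iff d p σ _).mp this
    rwa [hF] at this
  · rintro _ ⟨x, hx, rfl⟩ σ hσ
    have := hpE x hx ⟨σ, hσ⟩
    rw [← hF x] at this
    exact (eval_tensorPoint_eq_zero_iff d p ⟨σ, hσ⟩ (F x)).mpr this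

open scoped Classical in
/-- The universal minor with given pattern. -/
noncomputable def minorElement [∀ j, Finite (tensorShape d j)] (j : J) (w : tensorShape d j) {r : ℕ}
    (s : TensorPoint.MinorPattern (tensorShape d j) r) : B.Element :=
  ⟨FI.of (Quotient s), (Matrix.of fun i m => tensorEntry d (FI.of (Quotient s))
    ⟨j, Function.update (s.col m) w (s.row i)⟩).det⟩

/-- The universal admissible minors of size `r`. -/
def minorElements (r : ℕ) : Set B.Element :=
  {x | ∃ (j : J) (w : tensorShape d j) (s : TensorPoint.MinorPattern (tensorShape d j) r),
    TensorPoint.AdmissibleMinor w s.row s.col ∧ x = minorElement d j w s}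

theorem finite_minorElements [Finite J] (r : ℕ) : (minorElements d r).Finite := by
  refine (Set.finite_range fun q : Σ j, tensorShape d j ×
    TensorPoint.MinorPattern (tensorShape d j) r => minorElement d q.1 q.2.1 q.2.2).subset ?_
  rintro _ ⟨j, w, s, -, rfl⟩
  exact ⟨⟨j, w, s⟩, rfl⟩

/-- Every admissible minor at `p` is the image of the universal minor of its pattern under an
injection. -/
theorem tensorPoint_mem_rankClass {S : FI} (p : PrimeSpectrum (B.obj S)) (N : ℕ)
    (hp : p ∈ B.zeroLocus (minorElements d (N + 1)) S) :
    tensorPoint d p ∈ TensorPoint.rankClass K (tensorShape d) N := by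
  classical
  intro j w a c hac
  obtain ⟨s, ι, hι, rfl, rfl⟩ := TensorPoint.MinorPattern.exists_eq_comp a c
  have := hp _ ⟨j, w, s, hac.of_comp, rfl⟩ ⟨ι, hι⟩
  rw [← Ideal.algebraMap_residueField_eq_zero] at this
  refine Eq.trans ?_ this
  rw [TensorPoint.minor]
  change _ = algebraMap (B.obj S) p.asIdeal.ResidueField ((B.map (X := FI.of (Quotient s)) (Y := S)
    ⟨ι, hι⟩).hom (Matrix.det _))
  rw [AlgHom.map_det, RingHom.map_det]
  congr 1
  ext i m
  simp only [Matrix.of_apply, AlgHom.mapMatrix_apply, RingHom.mapMatrix_apply, Matrix.map_apply]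
  rw [map_tensorEntry]
  exact congrArg (fun g => algebraMap (B.obj S) p.asIdeal.ResidueField (tensorEntry d S ⟨j, g⟩))
    (Function.comp_update ι (s.col m) w (s.row i)).symm

/-- By `exists_eq_sum`, each entry of the flattening in `A` is a sum of products of a factor
depending on the row and one depending on the column. The number of terms bounds the rank; `N` is
its maximum over the finitely many flattenings. -/
theorem exists_minorElements_mem_ker [Finite J] {A : FIAlgebra K} (hA : A.IsGeneratedInWidthLE 1)
    (φ : B ⟶ A) : ∃ N, ∀ x ∈ minorElements d (N + 1), x.2 ∈ (ker φ).obj x.1 := by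
  classical
  choose n u v huv using fun q : Σ j, tensorShape d j =>
    hA.exists_eq_sum q.2 ((φ.app (d q.1).1).hom (d q.1).2)
  obtain ⟨N, hN⟩ := (Set.finite_range n).bddAbove
  refine ⟨N, ?_⟩
  rintro _ ⟨j, w, s, hs, rfl⟩
  let Q : FI := FI.of (Quotient s)
  -- The restrictions of the index map of entry `(i, m)` to `{w}` and to its complement depend on
  -- the row and on the column alone.
  let α : ∀ i, FI.of {t : tensorShape d j // t = w} ⟶ Q := fun i =>
    ⟨fun _ => s.row i, fun t t' _ => Subtype.ext (t.2.trans t'.2.symm)⟩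
  let β : ∀ m, FI.of {t : tensorShape d j // t ≠ w} ⟶ Q := fun m =>
    ⟨fun t => s.col m t.1, fun t t' e => Subtype.ext
      ((Function.injective_update_iff.mp (hs m m)).1 t.1 t'.1 t.2 t'.2 e)⟩
  change (φ.app Q).hom (Matrix.det _) = 0
  rw [AlgHom.map_det]
  refine Matrix.det_eq_zero_of_sum_range (hN ⟨⟨j, w⟩, rfl⟩) _
    (fun i k => (A.map (α i)).hom (u ⟨j, w⟩ k)) (fun m k => (A.map (β m)).hom (v ⟨j, w⟩ k)) ?_
  intro i m
  simp only [AlgHom.mapMatrix_apply, Matrix.map_apply, Matrix.of_apply]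
  have hinj : Function.Injective (Function.update (s.col m) w (s.row i)) := hs i m
  let f : (d j).1 ⟶ Q := ⟨Function.update (s.col m) w (s.row i), hinj⟩
  have hent : tensorEntry d Q ⟨j, Function.update (s.col m) w (s.row i)⟩ = (B.map f).hom (d j).2 :=
    dif_pos hinj
  have hα : inclusion (fun t => t = w) ≫ f = α i := by
    apply Function.Embedding.ext
    rintro ⟨t, rfl⟩
    exact Function.update_self t (s.row i) (s.col m)
  have hβ : inclusion (fun t => t ≠ w) ≫ f = β m := by
    apply Function.Embedding.ext
    rintro ⟨t, ht⟩
    exact Function.update_of_ne ht (s.row i) (s.col m)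
  rw [hent, app_map_apply, huv ⟨j, w⟩, map_sum]
  refine Finset.sum_congr rfl fun k _ => ?_
  rw [map_mul, map_map_apply, map_map_apply, hα, hβ]

end FIAlgebra

/-! ### Equations and ideals of the closure of the image. -/

namespace FIAlgebra

variable {K : Type u} [CommRing K]

theorem mem_zeroLocus {B : FIAlgebra K} {D : Set B.Element} {S : FI} {p : PrimeSpectrum (B.obj S)} :
    p ∈ B.zeroLocus D S ↔
      ∀ x ∈ D, ∀ σ : x.1 ⟶ S, (B.map σ).hom x.2 ∈ p.asIdeal := Iff.rfl

theorem mem_support_imageClosure_specMap {B A : FIAlgebra K} (φ : B ⟶ A) {S : FI}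
    (p : PrimeSpectrum (B.obj S)) :
    p ∈ (FIOpScheme.imageClosure (specMap φ)).support S ↔ (ker φ).obj S ≤ p.asIdeal := by
  rw [FIOpScheme.support_imageClosure]
  change p ∈ closure (Set.range (PrimeSpectrum.comap (φ.app S).hom.toRingHom)) ↔ _
  rw [PrimeSpectrum.closure_range_comap]
  rfl

theorem radical_eq_iff {B : FIAlgebra K} {I J : B.FIIdeal} : I.radical = J.radical ↔
    ∀ (S : FI) (p : PrimeSpectrum (B.obj S)), I.obj S ≤ p.asIdeal ↔ J.obj S ≤ p.asIdeal := by
  constructor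
  · intro h S p
    have hS : (I.obj S).radical = (J.obj S).radical := congrArg (fun I => FIIdeal.obj I S) h
    rw [← p.2.radical_le_iff, hS, p.2.radical_le_iff]
  · intro h
    apply FIIdeal.ext
    funext S
    change (I.obj S).radical = (J.obj S).radical
    rw [Ideal.radical_eq_sInf, Ideal.radical_eq_sInf]
    congr 1
    ext P
    exact and_congr_left fun hP => h S ⟨P, hP⟩

/-- The FI-ideal generated by a set of elements. -/
def spanFIIdeal {B : FIAlgebra K} (D : Set B.Element) : B.FIIdeal where
  obj S := Ideal.span {b | ∃ x ∈ D, ∃ σ : x.1 ⟶ S, (B.map σ).hom x.2 = b}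
  map_mem {S T} f a ha := by
    rw [← Ideal.mem_comap]
    revert a
    change _ ≤ Ideal.comap _ _
    rw [Ideal.span_le]
    rintro _ ⟨x, hx, σ, rfl⟩
    exact Ideal.subset_span ⟨x, hx, σ ≫ f, (map_map_apply B σ f x.2).symm⟩

theorem spanFIIdeal_isFinitelyGenerated {B : FIAlgebra K} {D : Set B.Element} (hD : D.Finite) :
    (spanFIIdeal D).IsFinitelyGenerated := by
  refine ⟨D, hD, fun x hx => Ideal.subset_span ⟨x, hx, 𝟙 _, ?_⟩, fun J hJ S => ?_⟩
  · rw [B.map_id]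
    rfl
  · refine Ideal.span_le.mpr ?_
    rintro _ ⟨x, hx, σ, rfl⟩
    exact J.map_mem σ (hJ x hx)

theorem spanFIIdeal_le_iff {B : FIAlgebra K} {D : Set B.Element} {S : FI}
    (p : PrimeSpectrum (B.obj S)) :
    (spanFIIdeal D).obj S ≤ p.asIdeal ↔ p ∈ B.zeroLocus D S := by
  refine Ideal.span_le.trans ⟨fun h x hx σ => h ⟨x, hx, σ, rfl⟩, ?_⟩
  rintro h _ ⟨x, hx, σ, rfl⟩
  exact h x hx σ

/-- The closure of the image of a morphism to an algebra generated in width at most one has a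
Noetherian system of equations. -/
theorem exists_finite_zeroLocus_subset_of_width [IsNoetherianRing K] {B A : FIAlgebra K}
    (hB : B.IsFinitelyGenerated) (hA : A.IsGeneratedInWidthLE 1) (φ : B ⟶ A) :
    ∃ D : Set B.Element, D.Finite ∧ (∀ x ∈ D, x.2 ∈ (ker φ).obj x.1) ∧
      ∀ E : Set B.Element, ∃ E₀ ⊆ E, E₀.Finite ∧ ∀ (S : FI) (p : PrimeSpectrum (B.obj S)),
        p ∈ B.zeroLocus D S → p ∈ B.zeroLocus E₀ S → p ∈ B.zeroLocus E S := by
  obtain ⟨m, d, hd⟩ := hB.exists_generators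
  obtain ⟨N, hN⟩ := exists_minorElements_mem_ker d hA φ
  refine ⟨minorElements d (N + 1), finite_minorElements d _, hN, fun E => ?_⟩
  obtain ⟨E₀, h₀, hf, h⟩ := exists_finite_zeroLocus_subset d hd N E
  exact ⟨E₀, h₀, hf, fun S p hp => h S p (tensorPoint_mem_rankClass d p N hp)⟩

theorem mem_zeroLocus_of_ker_le {B A : FIAlgebra K} {φ : B ⟶ A} {D : Set B.Element}
    (hD : ∀ x ∈ D, x.2 ∈ (ker φ).obj x.1) {S : FI} {p : PrimeSpectrum (B.obj S)}
    (hp : (ker φ).obj S ≤ p.asIdeal) : p ∈ B.zeroLocus D S :=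
  fun x hx σ => hp ((ker φ).map_mem σ (hD x hx))

/-- The minors cut out a locus containing the closure on which systems of equations are finite.
There the system of all elements of the kernel reduces to a finite one, and the minors themselves
are added to it. -/
theorem exists_finite_ker_le_iff [IsNoetherianRing K] {B A : FIAlgebra K}
    (hB : B.IsFinitelyGenerated) (hA : A.IsGeneratedInWidthLE 1) (φ : B ⟶ A) :
    ∃ D : Set B.Element, D.Finite ∧ ∀ (S : FI) (p : PrimeSpectrum (B.obj S)),
      (ker φ).obj S ≤ p.asIdeal ↔ p ∈ B.zeroLocus D S := by
  obtain ⟨D, hDf, hD, hE⟩ := exists_finite_zeroLocus_subset_of_width hB hA φ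
  obtain ⟨E₀, h₀, hf, h⟩ := hE {x | x.2 ∈ (ker φ).obj x.1}
  refine ⟨D ∪ E₀, hDf.union hf, fun S p => ⟨fun hp => ?_, fun hp b hb => ?_⟩⟩
  · exact mem_zeroLocus_of_ker_le (fun x hx => hx.elim (hD x) (fun hx => h₀ hx)) hp
  · have := h S p (fun x hx => hp x (Or.inl hx)) (fun x hx => hp x (Or.inr hx)) ⟨S, b⟩ hb (𝟙 S)
    rw [B.map_id] at this
    exact this

end FIAlgebra

/-! ### Reduced closed subschemes and descending chains. -/

theorem AlgebraicGeometry.Scheme.IdealSheafData.vanishingIdeal_support_of_isReduced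
    {X : Scheme.{u}} (I : X.IdealSheafData) [IsReduced I.subscheme] :
    vanishingIdeal I.support = I := by
  -- On the reduced scheme the ideal vanishing everywhere is the nilradical, hence zero; its
  -- pushforward along the immersion is `I`.
  have h := map_vanishingIdeal I.subschemeι ⊤
  rw [vanishingIdeal_top, nilradical_eq_bot, map_bot, ker_subschemeι] at h
  refine Eq.trans ?_ h.symm
  congr 1
  apply TopologicalSpace.Closeds.ext
  simp [range_subschemeι, I.support.isClosed.closure_eq]

namespace FIOpScheme

variable {K : Type u} [CommRing K]

namespace ClosedSubscheme

variable {X : FIOpScheme K}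

theorem res_mem_support (Z : X.ClosedSubscheme) {S T : FI} (f : S ⟶ T) {x : X.at_ T}
    (hx : x ∈ Z.support T) : X.res f x ∈ Z.support S := by
  obtain ⟨g, hg⟩ := Z.exists_restriction f
  rw [support, ← Scheme.IdealSheafData.range_subschemeι] at hx ⊢
  obtain ⟨z, rfl⟩ := hx
  refine ⟨g z, ?_⟩
  rw [← Scheme.Hom.comp_apply, ← Scheme.Hom.comp_apply, hg]

theorem ext_of_support {Z Z' : X.ClosedSubscheme} (hZ : Z.IsReduced) (hZ' : Z'.IsReduced)
    (h : ∀ S, Z.support S = Z'.support S) : Z = Z' := by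
  apply ClosedSubscheme.ext
  funext S
  have := hZ S
  have := hZ' S
  rw [← Scheme.IdealSheafData.vanishingIdeal_support_of_isReduced (Z.ideal S),
    ← Scheme.IdealSheafData.vanishingIdeal_support_of_isReduced (Z'.ideal S)]
  congr 1
  exact TopologicalSpace.Closeds.ext (h S)

theorem support_subset_of_le {Z Z' : X.ClosedSubscheme} (h : Z ≤ Z') (S : FI) :
    Z.support S ⊆ Z'.support S :=
  Scheme.IdealSheafData.support_antitone (h S)

/-- The closed immersion of a closed subscheme. -/
noncomputable def ι (Z : X.ClosedSubscheme) (S : FI) : Z.toFIOpScheme.at_ S ⟶ X.at_ S :=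
  (Z.ideal S).subschemeι

theorem isClosedEmbedding_ι (Z : X.ClosedSubscheme) (S : FI) :
    Topology.IsClosedEmbedding (Z.ι S) :=
  (Z.ideal S).subschemeι.isClosedEmbedding

theorem range_ι (Z : X.ClosedSubscheme) (S : FI) : Set.range (Z.ι S) = Z.support S :=
  Scheme.IdealSheafData.range_subschemeι _

theorem ι_res (Z : X.ClosedSubscheme) {S T : FI} (f : S ⟶ T) (z : Z.toFIOpScheme.at_ T) :
    X.res f (Z.ι T z) = Z.ι S (Z.toFIOpScheme.res f z) := by
  have h : Z.toFIOpScheme.res f ≫ Z.ι S = Z.ι T ≫ X.res f :=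
    (Z.exists_restriction f).choose_spec
  rw [← Scheme.Hom.comp_apply, ← Scheme.Hom.comp_apply, h]

end ClosedSubscheme

end FIOpScheme

namespace FIAlgebra

variable {K : Type u} [CommRing K]

/-- Noetherianity of a closed subscheme of a spectrum, from finiteness of systems of equations. -/
theorem isTopologicallyNoetherian_of_zeroLocus {B : FIAlgebra K} (Y : B.spec.ClosedSubscheme)
    (hY : ∀ E : Set B.Element, ∃ E₀ ⊆ E, E₀.Finite ∧ ∀ (S : FI), ∀ p ∈ Y.support S,
      p ∈ B.zeroLocus E₀ S → p ∈ B.zeroLocus E S) :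
    Y.toFIOpScheme.IsTopologicallyNoetherian := by
  intro Z hred hle
  let V : ℕ → ∀ S : FI, Set (PrimeSpectrum (B.obj S)) := fun n S => Y.ι S '' (Z n).support S
  have hV : ∀ n S, IsClosed (V n S) := fun n S =>
    (Y.isClosedEmbedding_ι S).isClosedMap _ ((Z n).ideal S).support.isClosed
  have hVmap : ∀ n {S T : FI} (f : S ⟶ T) (p : PrimeSpectrum (B.obj T)), p ∈ V n T →
      PrimeSpectrum.comap (B.map f).hom.toRingHom p ∈ V n S := by
    rintro n S T f _ ⟨z, hz, rfl⟩
    exact ⟨_, (Z n).res_mem_support f hz, (Y.ι_res f z).symm⟩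
  -- All equations of the `n`-th closed subset. They increase with `n`, so a finite subsystem of
  -- their union already occurs at one stage `N`, where the chain stops.
  let E : ℕ → Set B.Element := fun n =>
    {x | ∀ p ∈ V n x.1, x.2 ∈ p.asIdeal}
  have hanti : ∀ m n, m ≤ n → ∀ S, (Z n).support S ⊆ (Z m).support S := by
    intro m n hmn S
    exact antitone_nat_of_succ_le (f := fun n => (Z n).support S)
      (fun n => FIOpScheme.ClosedSubscheme.support_subset_of_le (hle n) S) hmn
  have hEmono : ∀ m n, m ≤ n → E m ⊆ E n := fun m n hmn x hx p hp =>
    hx p (Set.image_mono (hanti m n hmn x.1) hp)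
  have hVE : ∀ n S p, p ∈ V n S ↔ p ∈ B.zeroLocus (E n) S := by
    intro n S p
    constructor
    · exact fun hp x hx σ => hx _ (hVmap n σ p hp)
    · intro hp
      rw [← (hV n S).closure_eq, ← PrimeSpectrum.zeroLocus_vanishingIdeal_eq_closure]
      intro b hb
      have := hp ⟨S, b⟩ (fun q hq => (PrimeSpectrum.mem_vanishingIdeal _ _).mp hb q hq) (𝟙 S)
      rw [B.map_id] at this
      exact this
  obtain ⟨E₀, h₀, hf, hE⟩ := hY (⋃ n, E n)
  obtain ⟨N, hN⟩ : ∃ N, E₀ ⊆ E N := by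
    have := hf.to_subtype
    choose i hi using fun x : E₀ => Set.mem_iUnion.mp (h₀ x.2)
    obtain ⟨N, hN⟩ := (Set.finite_range i).bddAbove
    exact ⟨N, fun x hx => hEmono _ _ (hN ⟨⟨x, hx⟩, rfl⟩) (hi ⟨x, hx⟩)⟩
  refine ⟨N, fun n hn => FIOpScheme.ClosedSubscheme.ext_of_support (hred n) (hred N) fun S => ?_⟩
  refine (hanti N n hn S).antisymm fun z hz => ?_
  have hzV : Y.ι S z ∈ V N S := ⟨z, hz, rfl⟩
  have hzY : Y.ι S z ∈ Y.support S := Y.range_ι S ▸ Set.mem_range_self z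
  have := hE S _ hzY fun x hx => (hVE N S _).mp hzV x (hN hx)
  have hzn : Y.ι S z ∈ V n S := (hVE n S _).mpr fun x hx => this x (Set.mem_iUnion_of_mem n hx)
  obtain ⟨z', hz', e⟩ := hzn
  exact (Y.isClosedEmbedding_ι S).injective e ▸ hz'

end FIAlgebra

theorem mainTheorem1 {K : Type u} [CommRing K] [IsNoetherianRing K] (B A : FIAlgebra K)
    (hB : B.IsFinitelyGenerated) (hA : A.IsFinitelyGenerated) (hA1 : A.IsGeneratedInWidthLE 1)
    (φ : B ⟶ A) :
    (∃ D : Set B.Element, D.Finite ∧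
      ∀ S : FI, (FIOpScheme.imageClosure (FIAlgebra.specMap φ)).support S = B.zeroLocus D S) ∧
    (∃ I : B.FIIdeal, I.IsFinitelyGenerated ∧ I.radical = (FIAlgebra.ker φ).radical) ∧
    (FIOpScheme.imageClosure (FIAlgebra.specMap φ)).toFIOpScheme.IsTopologicallyNoetherian := by
  obtain ⟨D, hf, hD⟩ := FIAlgebra.exists_finite_ker_le_iff hB hA1 φ
  refine ⟨⟨D, hf, fun S => Set.ext fun p => ?_⟩, ⟨FIAlgebra.spanFIIdeal D,
    FIAlgebra.spanFIIdeal_isFinitelyGenerated hf, ?_⟩, ?_⟩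
  · exact (FIAlgebra.mem_support_imageClosure_specMap φ p).trans (hD S p)
  · exact FIAlgebra.radical_eq_iff.mpr fun S p =>
      (FIAlgebra.spanFIIdeal_le_iff p).trans (hD S p).symm
  · obtain ⟨D', -, hD', hE⟩ := FIAlgebra.exists_finite_zeroLocus_subset_of_width hB hA1 φ
    refine FIAlgebra.isTopologicallyNoetherian_of_zeroLocus _ fun E => ?_
    obtain ⟨E₀, h₀, hf₀, h⟩ := hE E
    exact ⟨E₀, h₀, hf₀, fun S p hp => h S p (FIAlgebra.mem_zeroLocus_of_ker_le hD'
      ((FIAlgebra.mem_support_imageClosure_specMap φ p).mp hp))⟩
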